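/- Let $n,d\ge 1$. Let $a^0_1,a^0_2,\dots\in\mathbb R^n$ and $X_0\in\mathbb R^{n\times d}$ be nonrandom, and let $\tilde c_1,\tilde c_2,\dots$ be mutually independent random vectors in $\mathbb R^{n+d}$, $\tilde c_i=(\delta_{ij})_{j=1}^{n+d}$, with $\mathbf E\tilde c_i=0$ and $\mathbf E\tilde c_i\tilde c_i^\top=\Sigma$ for all $i$, where $\Sigma$ (possibly singular) satisfies $\operatorname{rank}\bigl(\Sigma\binom{X_0}{-I_d}\bigr)=d$. For each sample size $m$ let $A_0=A_0(m)$ be the $m\times n$ matrix with rows $(a^0_i)^\top$, $\widetilde C$ the $m\times(n+d)$ matrix with rows $\tilde c_i^\top$, $i\le m$, and let $C=[A_0,\ A_0X_0]+\widetilde C$ be the observed matrix. Consider the total least squares problem of minimizing $\|\Delta(\Sigma^{1/2})^\dagger\|_F$ over $\Delta\in\mathbb R^{m\times(n+d)}$ subject to $$\Delta(I-P_\Sigma)=0,\qquad \operatorname{rank}(C-\Delta)\le n, \tag{TLS}$$ where ${}^\dagger$ is the Moore–Penrose pseudoinverse, $P_\Sigma=\Sigma\Sigma^\dagger$ is the orthogonal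 projector onto the column space of $\Sigma$, and $\|\cdot\|_F$ is the Frobenius norm. Consider the following three events (depending on $m$). 1. The minimum in (TLS) is attained; and for every $\Delta$ satisfying the constraints in (TLS) (in particular for every minimizer) there is an $(n+d)\times d$ matrix $\widehat X_{\rm ext}$ of full rank $d$ with $(C-\Delta)\widehat X_{\rm ext}=0$. 2. The problem (TLS) has a unique solution $\Delta$. 3. For every solution $\Delta$ of (TLS), the equation $(C-\Delta)\binom{\widehat X}{-I_d}=0$ has a unique solution $\widehat X\in\mathbb R^{n\times d}$. Write $\lambda_{\min}(m)$ for the smallest eigenvalue of $A_0(m)^\top A_0(m)$. (a) Suppose that for some $r\in[1,2]$, $\sup_{i\ge1,\,1\le j\le n+d}\mathbf E|\delta_{ij}|^{2r}<\infty$ and $m^{-1/r}\lambda_{\min}(m)\to\infty$ as $m\to\infty$. Then the three events occur with high probability, i.e. the probability that all three occur tends to $1$ as $m\to\infty$. (b) Suppose that either for some $r\ge2$ and $m_0\ge1$, $\sup_{i,j}\mathbf E|\delta_{ij}|^{2r}<\infty$ and $\sum_{m\ge m_0}\bigl(\sqrt m/\lambda_{\min}(m)\bigr)^r<\infty$; or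 for some $r\in[1,2]$ and $m_0\ge1$, $\sup_{i,j}\mathbf E|\delta_{ij}|^{2r}<\infty$ and $\sum_{m\ge m_0}\lambda_{\min}(m)^{-r}<\infty$ (in both sums a term with $\lambda_{\min}(m)=0$ is $+\infty$). Then the three events occur eventually, i.e. almost surely there is $m_1$ such that all three occur for every $m>m_1$. -/

import Mathlib

open MeasureTheory ProbabilityTheory Filter
open scoped Topology MatrixOrder

namespace TLS

noncomputable section

section Pseudoinverse

/-- `B` is the Moore–Penrose pseudoinverse of the real matrix `A`: the four Penrose equations. -/
def IsPinv {p q : Type*} [Fintype p] [Fintype q]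
    (A : Matrix p q ℝ) (B : Matrix q p ℝ) : Prop :=
  A * B * A = A ∧ B * A * B = B ∧ (A * B).transpose = A * B ∧ (B * A).transpose = B * A

theorem IsPinv.unique {p q : Type*} [Fintype p] [Fintype q]
    {A : Matrix p q ℝ} {B B' : Matrix q p ℝ} (h : IsPinv A B) (h' : IsPinv A B') : B = B' := by
  obtain ⟨h1, h2, h3, h4⟩ := h
  obtain ⟨k1, k2, k3, k4⟩ := h'
  have e1 : A * B = A * B' := by
    calc A * B = (A * B).transpose := h3.symm
      _ = ((A * B') * (A * B)).transpose := by rw [← Matrix.mul_assoc, k1]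
      _ = (A * B) * (A * B') := by rw [Matrix.transpose_mul, h3, k3]
      _ = A * B' := by rw [← Matrix.mul_assoc, h1]
  have e2 : B * A = B' * A := by
    calc B * A = (B * A).transpose := h4.symm
      _ = ((B * A) * (B' * A)).transpose := by
          rw [Matrix.mul_assoc, ← Matrix.mul_assoc A, k1]
      _ = (B' * A) * (B * A) := by rw [Matrix.transpose_mul, h4, k4]
      _ = B' * A := by rw [Matrix.mul_assoc, ← Matrix.mul_assoc A, h1]
  calc B = B * A * B := h2.symm
    _ = B' * (A * B) := by rw [e2, Matrix.mul_assoc]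
    _ = B' * A * B' := by rw [e1, Matrix.mul_assoc]
    _ = B' := k2

theorem exists_isPinv {p q : Type*} [Fintype p] [Fintype q] (A : Matrix p q ℝ) :
    ∃ B : Matrix q p ℝ, IsPinv A B := by
  classical
  have hH : (A.transpose * A).IsHermitian := by
    rw [← Matrix.conjTranspose_eq_transpose_of_trivial A]
    exact Matrix.isHermitian_conjTranspose_mul_self A
  obtain ⟨P, hPt, hHPH, hPHP, hcomm⟩ : ∃ P : Matrix q q ℝ, P.transpose = P ∧
      (A.transpose * A) * P * (A.transpose * A) = A.transpose * A ∧
      P * (A.transpose * A) * P = P ∧ P * (A.transpose * A) = (A.transpose * A) * P := by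
    have hs : ∀ f : ℝ → ℝ, ContinuousOn f (spectrum ℝ (A.transpose * A)) := fun f =>
      (Matrix.finite_real_spectrum (A := A.transpose * A)).continuousOn f
    have hsa : IsSelfAdjoint (A.transpose * A) := hH
    have hid : cfc (fun x : ℝ => x) (A.transpose * A) = A.transpose * A := cfc_id' ℝ _
    refine ⟨cfc (fun x : ℝ => x⁻¹) (A.transpose * A), ?_, ?_, ?_, ?_⟩
    · have := (cfc_predicate (R := ℝ) (fun x : ℝ => x⁻¹) (A.transpose * A) :
        IsSelfAdjoint (cfc (fun x : ℝ => x⁻¹) (A.transpose * A)))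
      simpa [IsSelfAdjoint, Matrix.star_eq_conjTranspose] using this
    · nth_rewrite 1 [← hid]
      nth_rewrite 3 [← hid]
      rw [← cfc_mul _ _ _ (hs _) (hs _), ← cfc_mul _ _ _ (hs _) (hs _)]
      simp only [mul_inv_mul_cancel]
      exact hid
    · nth_rewrite 2 [← hid]
      rw [← cfc_mul _ _ _ (hs _) (hs _), ← cfc_mul _ _ _ (hs _) (hs _)]
      congr 1
      funext x
      simpa using mul_inv_mul_cancel x⁻¹
    · have h := cfc_commute_cfc (fun x : ℝ => x⁻¹) (fun x : ℝ => x) (A.transpose * A)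
      rw [hid] at h
      exact h
  refine ⟨P * A.transpose, ?_, ?_, ?_, ?_⟩
  · have h0 : (A * P * A.transpose * A - A).transpose * (A * P * A.transpose * A - A) = 0 := by
      have e : A.transpose * (A * P * A.transpose * A - A) = 0 := by
        rw [Matrix.mul_sub, sub_eq_zero]
        simpa only [Matrix.mul_assoc] using hHPH
      have e' : (A * P * A.transpose * A - A).transpose
          = (P * (A.transpose * A) - 1).transpose * A.transpose := by
        rw [← Matrix.transpose_mul]
        congr 1
        simp only [Matrix.mul_sub, Matrix.mul_assoc, Matrix.mul_one]
      rw [e', Matrix.mul_assoc, e, Matrix.mul_zero]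
    rw [← Matrix.conjTranspose_eq_transpose_of_trivial] at h0
    have h1 := Matrix.conjTranspose_mul_self_eq_zero.mp h0
    rw [sub_eq_zero] at h1
    simpa only [Matrix.mul_assoc] using h1
  · calc P * A.transpose * A * (P * A.transpose)
        = P * (A.transpose * A) * P * A.transpose := by simp only [Matrix.mul_assoc]
      _ = P * A.transpose := by rw [hPHP]
  · simp only [Matrix.transpose_mul, Matrix.transpose_transpose, hPt, Matrix.mul_assoc]
  · rw [Matrix.mul_assoc, Matrix.transpose_mul, hPt, Matrix.transpose_mul,
      Matrix.transpose_transpose, hcomm]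

/-- The Moore–Penrose pseudoinverse of a real matrix. -/
def pinv {p q : Type*} [Fintype p] [Fintype q] (A : Matrix p q ℝ) : Matrix q p ℝ :=
  (exists_isPinv A).choose

theorem pinv_isPinv {p q : Type*} [Fintype p] [Fintype q] (A : Matrix p q ℝ) :
    IsPinv A (pinv A) :=
  (exists_isPinv A).choose_spec

end Pseudoinverse

section Linear

/-- The Frobenius norm `√(∑ M i j ^ 2)`. -/
def frobNorm {p q : Type*} [Fintype p] [Fintype q] (M : Matrix p q ℝ) : ℝ :=
  √(∑ i, ∑ j, M i j ^ 2)

/-- The smallest eigenvalue of `Mᵀ M` (for a nonempty index type `q`). -/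
def lambdaMinGram {p q : Type*} [Fintype p] [Fintype q] [DecidableEq q]
    (M : Matrix p q ℝ) : ℝ :=
  ⨅ i, (Matrix.isHermitian_conjTranspose_mul_self M).eigenvalues i

/-- The orthogonal projector `S S†` onto the column space of `S`. -/
def colProj {q : Type*} [Fintype q] (S : Matrix q q ℝ) : Matrix q q ℝ := S * pinv S

/-- The augmented matrix `(X; -I)`. -/
def augmented {n d : ℕ} (X : Matrix (Fin n) (Fin d) ℝ) : Matrix (Fin n ⊕ Fin d) (Fin d) ℝ :=
  Matrix.fromRows X (-1)

end Linear

section Problem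

variable {m n d : ℕ}

/-- The constraints `Δ (I - P_S) = 0` and `rank (C - Δ) ≤ n` of the TLS problem. -/
def Feasible (S : Matrix (Fin n ⊕ Fin d) (Fin n ⊕ Fin d) ℝ)
    (C Δ : Matrix (Fin m) (Fin n ⊕ Fin d) ℝ) : Prop :=
  Δ * (1 - colProj S) = 0 ∧ (C - Δ).rank ≤ n

/-- The TLS objective `‖Δ (S^{1/2})†‖_F`; `CFC.sqrt S` is the positive semidefinite square root
of the positive semidefinite matrix `S`. -/
def objective (S : Matrix (Fin n ⊕ Fin d) (Fin n ⊕ Fin d) ℝ)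
    (Δ : Matrix (Fin m) (Fin n ⊕ Fin d) ℝ) : ℝ :=
  frobNorm (Δ * pinv (CFC.sqrt S))

/-- `Δ` is a solution to the TLS problem: it satisfies the constraints and attains the minimum. -/
def IsSolution (S : Matrix (Fin n ⊕ Fin d) (Fin n ⊕ Fin d) ℝ)
    (C Δ : Matrix (Fin m) (Fin n ⊕ Fin d) ℝ) : Prop :=
  Feasible S C Δ ∧ ∀ Δ', Feasible S C Δ' → objective S Δ ≤ objective S Δ'

/-- The minimum is attained, and for every `Δ` that satisfies the constraints the equation
`(C - Δ) Xext = 0` has a solution of full rank `d`. -/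
def AttainedFullRank (S : Matrix (Fin n ⊕ Fin d) (Fin n ⊕ Fin d) ℝ)
    (C : Matrix (Fin m) (Fin n ⊕ Fin d) ℝ) : Prop :=
  (∃ Δ, IsSolution S C Δ) ∧
    ∀ Δ, Feasible S C Δ →
      ∃ Xext : Matrix (Fin n ⊕ Fin d) (Fin d) ℝ, (C - Δ) * Xext = 0 ∧ Xext.rank = d

/-- The TLS problem has a unique solution `Δ`. -/
def UniqueSolution (S : Matrix (Fin n ⊕ Fin d) (Fin n ⊕ Fin d) ℝ)
    (C : Matrix (Fin m) (Fin n ⊕ Fin d) ℝ) : Prop :=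
  ∃! Δ, IsSolution S C Δ

/-- For every solution `Δ`, the equation `(C - Δ) (X; -I) = 0` has a unique solution `X`. -/
def UniqueEstimate (S : Matrix (Fin n ⊕ Fin d) (Fin n ⊕ Fin d) ℝ)
    (C : Matrix (Fin m) (Fin n ⊕ Fin d) ℝ) : Prop :=
  ∀ Δ, IsSolution S C Δ → ∃! X : Matrix (Fin n) (Fin d) ℝ, (C - Δ) * augmented X = 0

end Problem

section Model

variable {Ω : Type*} [MeasurableSpace Ω] {n d : ℕ}

/-- The standing assumptions on the errors `c i` (the row of observation `i + 1`): independent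
random vectors, centred, with common covariance matrix `S`, and `rank (S (X₀; -I)) = d`. -/
structure ErrorModel (P : Measure Ω) (X₀ : Matrix (Fin n) (Fin d) ℝ)
    (S : Matrix (Fin n ⊕ Fin d) (Fin n ⊕ Fin d) ℝ)
    (c : ℕ → Ω → (Fin n ⊕ Fin d) → ℝ) : Prop where
  measurable : ∀ i, Measurable (c i)
  indep : iIndepFun c P
  memLp : ∀ i j, MemLp (fun ω => c i ω j) 2 P
  mean : ∀ i j, ∫ ω, c i ω j ∂P = 0
  cov : ∀ i j k, ∫ ω, c i ω j * c i ω k ∂P = S j k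
  rank_eq : (S * augmented X₀).rank = d

/-- The `m × n` matrix `A₀` of true regressors, with rows `a₀ 0, …, a₀ (m - 1)`. -/
def trueA (a₀ : ℕ → Fin n → ℝ) (m : ℕ) : Matrix (Fin m) (Fin n) ℝ :=
  Matrix.of fun (i : Fin m) j => a₀ i j

/-- The observed matrix `C = (A₀, A₀ X₀) + error`, of size `m × (n + d)`. -/
def observed (a₀ : ℕ → Fin n → ℝ) (X₀ : Matrix (Fin n) (Fin d) ℝ)
    (c : ℕ → Ω → (Fin n ⊕ Fin d) → ℝ) (m : ℕ) (ω : Ω) : Matrix (Fin m) (Fin n ⊕ Fin d) ℝ :=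
  Matrix.fromCols (trueA a₀ m) (trueA a₀ m * X₀) + Matrix.of fun (i : Fin m) j => c i ω j

/-- `sup_{i, j} E |δ_{i j}|^{2 r} < ∞`. -/
def BoundedMoments (P : Measure Ω) (c : ℕ → Ω → (Fin n ⊕ Fin d) → ℝ) (r : ℝ) : Prop :=
  ⨆ i, ⨆ j, ∫⁻ ω, ‖c i ω j‖ₑ ^ (2 * r) ∂P < ⊤

/-- The conditions for weak consistency: for some `1 ≤ r ≤ 2`, the moments of order `2 r` are
bounded and `m^{-1/r} λ_min(A₀ᵀ A₀) → ∞`. -/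
def WeakCondition (P : Measure Ω) (a₀ : ℕ → Fin n → ℝ)
    (c : ℕ → Ω → (Fin n ⊕ Fin d) → ℝ) : Prop :=
  ∃ r : ℝ, 1 ≤ r ∧ r ≤ 2 ∧ BoundedMoments P c r ∧
    Tendsto (fun m : ℕ => (m : ℝ) ^ (-(1 / r)) * lambdaMinGram (trueA a₀ m)) atTop atTop

/-- The first set of conditions for strong consistency: for some `r ≥ 2` and `m₀ ≥ 1`, the moments
of order `2 r` are bounded and `∑_{m ≥ m₀} (√m / λ_min(A₀ᵀ A₀))^r < ∞`.  A vanishing denominator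
makes the sum infinite, whence the positivity requirement. -/
def StrongConditionHigh (P : Measure Ω) (a₀ : ℕ → Fin n → ℝ)
    (c : ℕ → Ω → (Fin n ⊕ Fin d) → ℝ) : Prop :=
  ∃ r : ℝ, ∃ m₀ : ℕ, 2 ≤ r ∧ 1 ≤ m₀ ∧ BoundedMoments P c r ∧
    (∀ m, m₀ ≤ m → 0 < lambdaMinGram (trueA a₀ m)) ∧
    Summable fun k : ℕ =>
      (√((m₀ + k : ℕ) : ℝ) / lambdaMinGram (trueA a₀ (m₀ + k))) ^ r

/-- The second set of conditions for strong consistency: for some `1 ≤ r ≤ 2` and `m₀ ≥ 1`, the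
moments of order `2 r` are bounded and `∑_{m ≥ m₀} λ_min(A₀ᵀ A₀)^{-r} < ∞`. -/
def StrongConditionLow (P : Measure Ω) (a₀ : ℕ → Fin n → ℝ)
    (c : ℕ → Ω → (Fin n ⊕ Fin d) → ℝ) : Prop :=
  ∃ r : ℝ, ∃ m₀ : ℕ, 1 ≤ r ∧ r ≤ 2 ∧ 1 ≤ m₀ ∧ BoundedMoments P c r ∧
    (∀ m, m₀ ≤ m → 0 < lambdaMinGram (trueA a₀ m)) ∧
    Summable fun k : ℕ => 1 / lambdaMinGram (trueA a₀ (m₀ + k)) ^ r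

/-- The events `E m` occur with high probability: the probability of the complement tends to `0`.
(For an event not known to be measurable, this is the stronger reading: `P` is an outer measure on
all sets, so it implies that `P (E m)` tends to `1`.) -/
def WithHighProbability (P : Measure Ω) (E : ℕ → Ω → Prop) : Prop :=
  Tendsto (fun m => P {ω | ¬ E m ω}) atTop (𝓝 0)

/-- The events `E m` occur eventually: almost surely, `E m` occurs for all large `m`. -/
def OccursEventually (P : Measure Ω) (E : ℕ → Ω → Prop) : Prop :=
  ∀ᵐ ω ∂P, ∃ m₀ : ℕ, ∀ m, m₀ < m → E m ω

end Model

end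

end TLS

/-! The deterministic core concerns the quadratic form `q(v) = ‖C v‖² - τ vᵀ S v`. If `q` is
negative definite on the `d`-dimensional column space of `(X₀; -I)` and positive definite on `ℝⁿ ×
0`, its signature is `(n, d)` by Sylvester's law of inertia. Diagonalize `S` and `CᵀC`
simultaneously, with entries `D i ∈ {0, 1}` and `μ i`: exactly `d` indices satisfy `μ i < τ D i`,
none gives equality, and those `d` have `D i = 1`. In these coordinates the objective is the
Frobenius norm, the first constraint says that only columns with `D i = 1` may change, and the
columns of `C` are orthogonal. An Eckart–Young argument, with `τ` separating the deleted columns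
from the kept ones, shows that the unique minimizer deletes those `d` columns. The kernel of the
corrected matrix is then a `d`-dimensional space on which `q` is negative definite. It meets `ℝⁿ ×
0` only in `0`, hence is the column space of exactly one `(X; -I)`. This is
`wellPosed_of_quadratic_forms`.

Now write `C = A₀ T + E` with `T = (I, X₀)` and `λ = λ_min(A₀ᵀ A₀)`, and take `τ = m + η λ` with a
small constant `η`. Since `‖E v‖²` is close to `m vᵀ S v`, the term `η λ vᵀ S v` makes `q` negative
where `T v = 0`, while `‖A₀ T v‖² ≥ λ ‖v‖²` makes it positive on `ℝⁿ × 0`. It suffices that `EᵀE - m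
S` and the squared components of `E` along an orthonormal basis of the columns of `A₀` be at most a
small multiple of `λ` (`exists_wellPosed_of_perturbation`).

These are finitely many scalar conditions on independent sums. For weak consistency, a von
Bahr–Esseen type bound (`integral_abs_sum_le`) handles the covariances and Chebyshev the components.
For strong consistency with `r ≤ 2`, the covariances obey a strong law (martingale convergence and
Kronecker's lemma), and the components a tail bound of order `λ^(-r) + λ^(-2)`, to which
Borel–Cantelli applies. The case `r ≥ 2` reduces to exponent `2` because `λ_min` is monotone in `m`.
-/

namespace TLS

/-! ### Simultaneous diagonalization of two positive semidefinite forms -/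

section SimultaneousDiagonalization

open Matrix

variable {ι : Type*} [Fintype ι] [DecidableEq ι]

theorem exists_transpose_mul_self_of_posDef {A : Matrix ι ι ℝ} (hA : A.PosDef) :
    ∃ B B' : Matrix ι ι ℝ, B * B' = 1 ∧ B' * B = 1 ∧ A = B.transpose * B := by
  have h0 : 0 ≤ A := hA.posSemidef.nonneg
  have hs : CFC.sqrt A * CFC.sqrt A = A := CFC.sqrt_mul_sqrt_self A h0
  have ht : (CFC.sqrt A).transpose = CFC.sqrt A := by
    have h : (CFC.sqrt A).IsHermitian := (CFC.sqrt_nonneg A).posSemidef.isHermitian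
    rw [← conjTranspose_eq_transpose_of_trivial]
    exact h
  have hu : IsUnit (CFC.sqrt A) := by
    have := hA.isUnit
    rw [← hs] at this
    exact isUnit_of_mul_isUnit_left this
  obtain ⟨u, hu⟩ := hu
  refine ⟨CFC.sqrt A, (u⁻¹ : (Matrix ι ι ℝ)ˣ), ?_, ?_, ?_⟩
  · rw [← hu]; exact u.mul_inv
  · rw [← hu]; exact u.inv_mul
  · rw [ht, hs]

/-- A congruence turns `S + G` into the identity; an orthogonal matrix diagonalizing the transformed
`S` then diagonalizes `G = (S + G) - S` too. A final rescaling normalizes the nonzero entries of `S`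
to `1`. -/
theorem exists_simultaneous_diagonalization {S G : Matrix ι ι ℝ} (hS : S.PosSemidef)
    (hG : G.PosSemidef) (hSG : (S + G).PosDef) :
    ∃ (M M' : Matrix ι ι ℝ) (D μ : ι → ℝ), M * M' = 1 ∧ M' * M = 1 ∧
      (∀ i, D i = 0 ∨ D i = 1) ∧ (∀ i, 0 ≤ μ i) ∧
      M.transpose * S * M = diagonal D ∧ M.transpose * G * M = diagonal μ := by
  obtain ⟨B, B', hB, hB', hSGB⟩ := exists_transpose_mul_self_of_posDef hSG
  have hS1 : (B'.transpose * S * B').IsHermitian := by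
    rw [← conjTranspose_eq_transpose_of_trivial]
    exact isHermitian_conjTranspose_mul_mul B' hS.isHermitian
  set U : Matrix ι ι ℝ := (hS1.eigenvectorUnitary : Matrix ι ι ℝ) with hU
  have hUU : U.transpose * U = 1 := by
    have := Matrix.mem_unitaryGroup_iff'.mp (hS1.eigenvectorUnitary).2
    rwa [star_eq_conjTranspose, conjTranspose_eq_transpose_of_trivial] at this
  have hUU' : U * U.transpose = 1 := mul_eq_one_comm.mp hUU
  set σ := hS1.eigenvalues with hσ
  have hdiag : U.transpose * (B'.transpose * S * B') * U = diagonal σ := by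
    have h := hS1.conjStarAlgAut_star_eigenvectorUnitary
    rw [Unitary.conjStarAlgAut_apply] at h
    simpa [star_eq_conjTranspose, conjTranspose_eq_transpose_of_trivial, hU] using h
  have hσ0 : ∀ i, 0 ≤ σ i := by
    have : (B'.transpose * S * B').PosSemidef := by
      rw [← conjTranspose_eq_transpose_of_trivial]
      exact hS.conjTranspose_mul_mul_same B'
    exact this.eigenvalues_nonneg
  -- The scaling `σ^(-1/2)` sends a nonzero eigenvalue `σ` of `S` to `1`; on the kernel of `S` no
  -- scaling is needed, and `1` keeps `t` invertible.
  set t : ι → ℝ := fun i => if σ i = 0 then 1 else (√(σ i))⁻¹ with ht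
  have ht0 : ∀ i, t i ≠ 0 := by
    intro i
    simp only [ht]
    split_ifs with h
    · exact one_ne_zero
    · exact inv_ne_zero (Real.sqrt_ne_zero'.mpr (lt_of_le_of_ne (hσ0 i) (Ne.symm h)))
  have hTT : diagonal t * diagonal (fun i => (t i)⁻¹) = 1 := by
    rw [diagonal_mul_diagonal]
    simp [ht0]
  have hTT' : diagonal (fun i => (t i)⁻¹) * diagonal t = 1 := mul_eq_one_comm.mp hTT
  have hSG1 : U.transpose * (B'.transpose * (S + G) * B') * U = 1 := by
    rw [hSGB]
    have : B'.transpose * (B.transpose * B) * B' = 1 := by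
      rw [Matrix.mul_assoc, Matrix.mul_assoc, hB, Matrix.mul_one, ← transpose_mul, hB,
        transpose_one]
    rw [this, Matrix.mul_one, hUU]
  have hGdiag : U.transpose * (B'.transpose * G * B') * U = diagonal fun i => 1 - σ i := by
    have e : U.transpose * (B'.transpose * G * B') * U
        = U.transpose * (B'.transpose * (S + G) * B') * U
          - U.transpose * (B'.transpose * S * B') * U := by
      simp only [Matrix.mul_add, Matrix.add_mul]
      abel
    rw [e, hSG1, hdiag, ← diagonal_one, diagonal_sub]
  have hconj : ∀ Q : Matrix ι ι ℝ, (B' * U * diagonal t).transpose * Q * (B' * U * diagonal t)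
      = diagonal t * (U.transpose * (B'.transpose * Q * B') * U) * diagonal t := by
    intro Q
    simp only [transpose_mul, diagonal_transpose, Matrix.mul_assoc]
  refine ⟨B' * U * diagonal t, diagonal (fun i => (t i)⁻¹) * U.transpose * B,
    fun i => t i * σ i * t i, fun i => t i * (1 - σ i) * t i, ?_, ?_, ?_, ?_, ?_, ?_⟩
  · calc B' * U * diagonal t * (diagonal (fun i => (t i)⁻¹) * U.transpose * B)
        = B' * (U * (diagonal t * diagonal (fun i => (t i)⁻¹)) * U.transpose) * B := by
          simp only [Matrix.mul_assoc]
      _ = 1 := by rw [hTT, Matrix.mul_one, hUU', Matrix.mul_one, hB']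
  · calc diagonal (fun i => (t i)⁻¹) * U.transpose * B * (B' * U * diagonal t)
        = diagonal (fun i => (t i)⁻¹) * (U.transpose * (B * B') * U) * diagonal t := by
          simp only [Matrix.mul_assoc]
      _ = 1 := by rw [hB, Matrix.mul_one, hUU, Matrix.mul_one, hTT']
  · intro i
    simp only [ht]
    split_ifs with h
    · left; simp [h]
    · right
      have hpos : 0 < σ i := lt_of_le_of_ne (hσ0 i) (Ne.symm h)
      have h1 : √(σ i) ≠ 0 := Real.sqrt_ne_zero'.mpr hpos
      field_simp
      exact (Real.sq_sqrt hpos.le).symm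
  · have h1 : (diagonal fun i => 1 - σ i).PosSemidef := by
      rw [← hGdiag]
      have := (hG.conjTranspose_mul_mul_same B').conjTranspose_mul_mul_same U
      simpa only [conjTranspose_eq_transpose_of_trivial] using this
    intro i
    have h2 : 0 ≤ 1 - σ i := Matrix.posSemidef_diagonal_iff.mp h1 i
    have := mul_nonneg h2 (mul_self_nonneg (t i))
    calc (0 : ℝ) ≤ (1 - σ i) * (t i * t i) := this
      _ = t i * (1 - σ i) * t i := by ring
  · rw [hconj, hdiag, diagonal_mul_diagonal, diagonal_mul_diagonal]
  · rw [hconj, hGdiag, diagonal_mul_diagonal, diagonal_mul_diagonal]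

end SimultaneousDiagonalization

/-! ### A constrained Eckart–Young theorem -/

section Frobenius

open Matrix

variable {p q ι : Type*} [Fintype p] [Fintype q] [Fintype ι] [DecidableEq ι]

theorem trace_transpose_mul_self_nonneg (A : Matrix p q ℝ) : 0 ≤ (A.transpose * A).trace := by
  simp only [trace, diag_apply, mul_apply, transpose_apply]
  exact Finset.sum_nonneg fun i _ => Finset.sum_nonneg fun j _ => mul_self_nonneg _

theorem trace_transpose_mul_self_eq_zero {A : Matrix p q ℝ} (h : (A.transpose * A).trace = 0) :
    A = 0 := by
  rw [← conjTranspose_eq_transpose_of_trivial] at h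
  exact trace_conjTranspose_mul_self_eq_zero_iff.mp h

theorem frobNorm_eq_sqrt_trace (A : Matrix p q ℝ) :
    frobNorm A = √((A.transpose * A).trace) := by
  simp only [frobNorm, trace, diag_apply, mul_apply, transpose_apply]
  rw [Finset.sum_comm]
  simp only [sq]

/-- Eckart–Young for a matrix `C` with orthogonal columns, when the perturbation `δ` may only
change the columns `i` with `D i = 1`: the squared Frobenius norm of a perturbation making
`C - δ` vanish on a `k`-dimensional space is at least the sum of the `k` smallest squared norms of
columns, with equality only if `δ` removes precisely these columns. -/
theorem trace_le_of_kernel {k : ℕ} {C δ : Matrix p ι ℝ} {D μ : ι → ℝ} {τ : ℝ}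
    {Z : Matrix ι (Fin k) ℝ}
    (hD : ∀ i, D i = 0 ∨ D i = 1) (hC : C.transpose * C = diagonal μ)
    {J : Finset ι} (hJ : J.card = k) (hJD : ∀ i ∈ J, D i = 1) (hlow : ∀ i ∈ J, μ i < τ)
    (hhigh : ∀ i, i ∉ J → τ * D i < μ i)
    (hδ : δ * diagonal D = δ) (hker : (C - δ) * Z = 0)
    (hZ : Z.transpose * diagonal D * Z = 1) :
    ∑ i ∈ J, μ i ≤ (δ.transpose * δ).trace ∧
      ((δ.transpose * δ).trace = ∑ i ∈ J, μ i →
        δ = C * diagonal (fun i => if i ∈ J then (1 : ℝ) else 0)) := by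
  have hDD : diagonal D * diagonal D = diagonal D := by
    rw [diagonal_mul_diagonal]
    congr 1
    funext i
    rcases hD i with h | h <;> simp [h]
  -- `Y` has orthonormal columns, and `δ Y = δ Z = C Z` because `δ` ignores the coordinates with `D
  -- i = 0`. So `C Z` is the part of `δ` that the kernel condition forces.
  set Y := diagonal D * Z with hY
  have hYY : Y.transpose * Y = 1 := by
    rw [hY, transpose_mul, diagonal_transpose, Matrix.mul_assoc, ← Matrix.mul_assoc (diagonal D),
      hDD, ← Matrix.mul_assoc, hZ]
  have hδY : δ * Y = C * Z := by
    rw [hY, ← Matrix.mul_assoc, hδ]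
    rw [Matrix.sub_mul, sub_eq_zero] at hker
    exact hker.symm
  -- the Pythagorean identity
  have hpyth : (δ.transpose * δ).trace
      = ((δ - δ * Y * Y.transpose).transpose * (δ - δ * Y * Y.transpose)).trace
        + ((C * Z).transpose * (C * Z)).trace := by
    have e1 : ((δ - δ * Y * Y.transpose).transpose * (δ - δ * Y * Y.transpose)).trace
        = (δ.transpose * δ).trace - (δ.transpose * (δ * Y * Y.transpose)).trace
          - ((δ * Y * Y.transpose).transpose * δ).trace
          + ((δ * Y * Y.transpose).transpose * (δ * Y * Y.transpose)).trace := by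
      rw [transpose_sub, Matrix.sub_mul, Matrix.mul_sub, Matrix.mul_sub, trace_sub, trace_sub,
        trace_sub]
      ring
    have e2 : (δ.transpose * (δ * Y * Y.transpose)).trace
        = ((C * Z).transpose * (C * Z)).trace := by
      rw [← hδY, ← Matrix.mul_assoc, trace_mul_comm, transpose_mul δ Y, Matrix.mul_assoc]
    have e3 : ((δ * Y * Y.transpose).transpose * δ).trace
        = ((C * Z).transpose * (C * Z)).trace := by
      rw [← e2, ← trace_transpose, transpose_mul, transpose_transpose]
    have e4 : ((δ * Y * Y.transpose).transpose * (δ * Y * Y.transpose)).trace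
        = ((C * Z).transpose * (C * Z)).trace := by
      rw [← hδY, transpose_mul, transpose_transpose, ← Matrix.mul_assoc, trace_mul_comm,
        Matrix.mul_assoc, ← Matrix.mul_assoc, ← Matrix.mul_assoc, hYY, Matrix.one_mul]
    rw [e1, e2, e3, e4]
    ring
  -- The squared row norms of `Z` act as weights: `‖C Z‖² = ∑ μ i π i`, with `∑ D i π i = k` and `π
  -- i ≤ 1` on `J`. What remains is a linear program in `π`, with `τ` as the multiplier of the sum
  -- constraint.
  set π : ι → ℝ := fun i => (Z * Z.transpose) i i with hπ
  have hπ_eq : ∀ i, π i = ∑ j, Z i j ^ 2 := by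
    intro i
    simp only [hπ, mul_apply, transpose_apply, sq]
  have hπ0 : ∀ i, 0 ≤ π i := fun i => by
    rw [hπ_eq]; exact Finset.sum_nonneg fun j _ => sq_nonneg _
  have htr : ((C * Z).transpose * (C * Z)).trace = ∑ i, μ i * π i := by
    rw [transpose_mul, Matrix.mul_assoc, trace_mul_comm, ← Matrix.mul_assoc C.transpose, hC,
      Matrix.mul_assoc, trace]
    simp only [diag_apply, diagonal_mul, hπ]
  have hsumD : ∑ i, D i * π i = k := by
    have : (Z.transpose * diagonal D * Z).trace = k := by rw [hZ, trace_one, Fintype.card_fin]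
    rw [← this, Matrix.mul_assoc, trace_mul_comm, Matrix.mul_assoc, trace]
    simp only [diag_apply, diagonal_mul, hπ]
  have hπ1 : ∀ i ∈ J, π i ≤ 1 := by
    intro i hi
    -- `1 - Y Yᵀ` is an orthogonal projector, so its diagonal entries are sums of squares.
    have hE : ((1 - Y * Y.transpose).transpose * (1 - Y * Y.transpose)) = 1 - Y * Y.transpose := by
      have : Y * Y.transpose * (Y * Y.transpose) = Y * Y.transpose := by
        rw [Matrix.mul_assoc, ← Matrix.mul_assoc Y.transpose, hYY, Matrix.one_mul]
      rw [transpose_sub, transpose_one, transpose_mul, transpose_transpose, Matrix.sub_mul,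
        Matrix.mul_sub, Matrix.one_mul, Matrix.mul_sub, this]
      simp
    have h1 : 0 ≤ (1 - Y * Y.transpose : Matrix ι ι ℝ) i i := by
      rw [← hE, mul_apply]
      exact Finset.sum_nonneg fun j _ => mul_self_nonneg _
    have h2 : (Y * Y.transpose) i i = π i := by
      have e : ∀ j, Y i j = Z i j := fun j => by rw [hY, diagonal_mul, hJD i hi, one_mul]
      simp only [hπ, mul_apply, transpose_apply, e]
    rw [Matrix.sub_apply, one_apply_eq, h2] at h1
    linarith
  -- the weighted sum of the `μ i`
  have hsplit : ∑ i, μ i * π i - ∑ i ∈ J, μ i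
      = ∑ i, (if i ∈ J then (τ - μ i) * (1 - π i) else (μ i - τ * D i) * π i) := by
    have e : ∀ i, (if i ∈ J then (τ - μ i) * (1 - π i) else (μ i - τ * D i) * π i)
        = (μ i * π i - τ * (D i * π i)) + (if i ∈ J then τ - μ i else 0) := by
      intro i
      split_ifs with h
      · rw [hJD i h]; ring
      · ring
    simp only [e]
    rw [Finset.sum_add_distrib, Finset.sum_sub_distrib, ← Finset.mul_sum, hsumD,
      Finset.sum_ite_mem, Finset.univ_inter, Finset.sum_sub_distrib, Finset.sum_const, hJ,
      nsmul_eq_mul]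
    ring
  have hterm : ∀ i, 0 ≤ (if i ∈ J then (τ - μ i) * (1 - π i) else (μ i - τ * D i) * π i) := by
    intro i
    split_ifs with h
    · exact mul_nonneg (by linarith [hlow i h]) (by linarith [hπ1 i h])
    · exact mul_nonneg (by linarith [hhigh i h]) (hπ0 i)
  have hge : 0 ≤ ∑ i, μ i * π i - ∑ i ∈ J, μ i := by
    rw [hsplit]; exact Finset.sum_nonneg fun i _ => hterm i
  have hres := trace_transpose_mul_self_nonneg (δ - δ * Y * Y.transpose)
  refine ⟨by rw [hpyth, htr]; linarith, fun heq => ?_⟩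
  rw [hpyth, htr] at heq
  have hres0 : δ - δ * Y * Y.transpose = 0 := trace_transpose_mul_self_eq_zero (by linarith)
  have hsum0 : ∑ i, (if i ∈ J then (τ - μ i) * (1 - π i) else (μ i - τ * D i) * π i) = 0 := by
    rw [← hsplit]; linarith
  have hall := (Finset.sum_eq_zero_iff_of_nonneg fun i _ => hterm i).mp hsum0
  -- Equality kills each term of the sum; the strict inequality off `J` then forces the rows of `Z`
  -- outside `J` to vanish.
  have hZ0 : ∀ i, i ∉ J → ∀ j, Z i j = 0 := by
    intro i hi j
    have h1 := hall i (Finset.mem_univ i)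
    rw [if_neg hi] at h1
    have h2 : π i = 0 := by
      rcases mul_eq_zero.mp h1 with h | h
      · linarith [hhigh i hi]
      · exact h
    rw [hπ_eq, Finset.sum_eq_zero_iff_of_nonneg fun j _ => sq_nonneg _] at h2
    exact pow_eq_zero_iff two_ne_zero |>.mp (h2 j (Finset.mem_univ j))
  set DJ : Matrix ι ι ℝ := diagonal (fun i => if i ∈ J then 1 else 0) with hDJ
  have hDJZ : DJ * Z = Z := by
    ext i j
    rw [hDJ, diagonal_mul]
    split_ifs with h
    · rw [one_mul]
    · rw [hZ0 i h j, mul_zero]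
  have hYZ : Y = Z := by
    ext i j
    rw [hY, diagonal_mul]
    by_cases h : i ∈ J
    · rw [hJD i h, one_mul]
    · rw [hZ0 i h j, mul_zero]
  rw [hYZ] at hYY hres0 hδY
  have hDJt : DJ.transpose = DJ := diagonal_transpose _
  have hDJ2 : DJ * DJ = DJ := by
    rw [hDJ, diagonal_mul_diagonal]
    congr 1
    funext i
    split_ifs <;> simp
  have hZDJ : Z.transpose * DJ = Z.transpose := by
    rw [← hDJt, ← transpose_mul, hDJZ]
  -- `DJ - Z Zᵀ` is an orthogonal projector of trace `k - k = 0`.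
  have hZZ : DJ - Z * Z.transpose = 0 := by
    apply trace_transpose_mul_self_eq_zero
    have e : (DJ - Z * Z.transpose).transpose * (DJ - Z * Z.transpose) = DJ - Z * Z.transpose := by
      have e1 : Z * Z.transpose * (Z * Z.transpose) = Z * Z.transpose := by
        rw [Matrix.mul_assoc, ← Matrix.mul_assoc Z.transpose, hYY, Matrix.one_mul]
      rw [transpose_sub, hDJt, transpose_mul, transpose_transpose, Matrix.sub_mul, Matrix.mul_sub,
        Matrix.mul_sub, hDJ2, e1, ← Matrix.mul_assoc DJ, hDJZ, Matrix.mul_assoc Z, hZDJ]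
      simp
    rw [e, trace_sub, trace_mul_comm Z, hYY, trace_one, hDJ, trace_diagonal, Fintype.card_fin]
    simp [hJ]
  rw [sub_eq_zero] at hZZ hres0
  rw [hZZ, ← Matrix.mul_assoc, ← hδY]
  exact hres0

end Frobenius

end TLS

namespace TLS

/-! ### Dimension counts -/

section RankNullity

open Matrix

theorem eq_zero_of_mulVec_eq_zero_of_rank {q : Type*} [Finite q] {d : ℕ}
    {A : Matrix q (Fin d) ℝ} (hA : A.rank = d) {x : Fin d → ℝ} (hx : A *ᵥ x = 0) : x = 0 := by
  have := Fintype.ofFinite q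
  have h := LinearMap.finrank_range_add_finrank_ker A.mulVecLin
  have hA' : Module.finrank ℝ (LinearMap.range A.mulVecLin) = d := hA
  rw [hA', Module.finrank_fin_fun] at h
  have h0 : Module.finrank ℝ (LinearMap.ker A.mulVecLin) = 0 := by omega
  have hbot := Submodule.finrank_eq_zero.mp h0
  have hmem : x ∈ LinearMap.ker A.mulVecLin := by simpa using hx
  rw [hbot] at hmem
  simpa using hmem

theorem exists_mul_eq_zero_of_rank_le {m n d : ℕ} {A : Matrix (Fin m) (Fin n ⊕ Fin d) ℝ}
    (hA : A.rank ≤ n) : ∃ Z : Matrix (Fin n ⊕ Fin d) (Fin d) ℝ, A * Z = 0 ∧ Z.rank = d := by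
  have h := LinearMap.finrank_range_add_finrank_ker A.mulVecLin
  have hA' : Module.finrank ℝ (LinearMap.range A.mulVecLin) ≤ n := hA
  rw [Module.finrank_fintype_fun_eq_card, Fintype.card_sum, Fintype.card_fin, Fintype.card_fin] at h
  have hd : d ≤ Module.finrank ℝ (LinearMap.ker A.mulVecLin) := by omega
  let b := Module.finBasis ℝ (LinearMap.ker A.mulVecLin)
  let v : Fin d → (Fin n ⊕ Fin d → ℝ) := fun j => (b (Fin.castLE hd j) : Fin n ⊕ Fin d → ℝ)
  have hv : LinearIndependent ℝ v := by
    have h1 := b.linearIndependent.comp _ (Fin.castLE_injective hd)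
    exact h1.map' (LinearMap.ker A.mulVecLin).subtype (Submodule.ker_subtype _)
  refine ⟨(Matrix.of v).transpose, ?_, ?_⟩
  · ext i j
    have h1 : A *ᵥ v j = 0 := LinearMap.mem_ker.mp (b (Fin.castLE hd j)).2
    have h2 := congrFun h1 i
    simpa [mul_apply, mulVec, dotProduct] using h2
  · rw [rank_transpose]
    have := LinearIndependent.rank_matrix (M := Matrix.of v) hv
    simpa using this

/-- The half of Sylvester's law that is needed: a coordinate subspace meeting `ker L` only in `0`
embeds into `ℝᵏ`, and bijectively when the dimensions agree. The surjectivity later produces the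
estimate `X`. -/
theorem card_le_of_injOn_support {ι : Type*} [Fintype ι] [DecidableEq ι] {k : ℕ} (s : Finset ι)
    (L : (ι → ℝ) →ₗ[ℝ] (Fin k → ℝ))
    (hL : ∀ z, (∀ i, i ∉ s → z i = 0) → L z = 0 → z = 0) :
    s.card ≤ k ∧ (s.card = k → ∀ y, ∃ z, (∀ i, i ∉ s → z i = 0) ∧ L z = y) := by
  let E := Function.ExtendByZero.linearMap ℝ (Subtype.val : s → ι)
  have hE : ∀ z i, i ∉ s → E z i = 0 := by
    intro z i hi
    simp only [E, Function.ExtendByZero.linearMap_apply]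
    exact Function.extend_apply' _ _ _ (by rintro ⟨a, rfl⟩; exact hi a.2)
  have hE' : ∀ z (i : s), E z i = z i := by
    intro z i
    simp only [E, Function.ExtendByZero.linearMap_apply]
    exact Subtype.val_injective.extend_apply _ _ _
  have hinj : Function.Injective (L ∘ₗ E) := by
    rw [← LinearMap.ker_eq_bot, LinearMap.ker_eq_bot']
    intro z hz
    have := hL (E z) (hE z) hz
    funext i
    exact (hE' z i).symm.trans (congrFun this i)
  refine ⟨?_, fun hs y => ?_⟩
  · have := LinearMap.finrank_le_finrank_of_injective hinj
    simpa using this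
  · have hsurj : Function.Surjective (L ∘ₗ E) :=
      (LinearMap.injective_iff_surjective_of_finrank_eq_finrank (by simp [hs])).mp hinj
    obtain ⟨z, hz⟩ := hsurj y
    exact ⟨E z, hE z, hz⟩

end RankNullity

/-! ### Constraint and objective in diagonalizing coordinates -/

section Reduction

open Matrix

variable {p ι : Type*} [Fintype p] [Fintype ι] [DecidableEq ι]

/-- For symmetric `S`, transposing the Penrose equations shows that `S S†` also acts as the identity
to the right of `S`. Feasible perturbations thus factor through `S`, and in particular vanish on its
kernel. -/
theorem mul_one_sub_colProj_eq_zero_iff {p : Type*} {S : Matrix ι ι ℝ} (hS : S.transpose = S)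
    {Δ : Matrix p ι ℝ} : Δ * (1 - colProj S) = 0 ↔ ∃ X : Matrix p ι ℝ, Δ = X * S := by
  obtain ⟨h1, -, h3, -⟩ := pinv_isPinv S
  have hP : colProj S = (pinv S).transpose * S := by
    rw [colProj, ← h3, transpose_mul, hS]
  have hSP : S * colProj S = S := by
    have := congrArg transpose h1
    rw [transpose_mul, transpose_mul, hS] at this
    rw [hP, this]
  constructor
  · intro h
    rw [Matrix.mul_sub, Matrix.mul_one, sub_eq_zero] at h
    exact ⟨Δ * (pinv S).transpose, by rw [Matrix.mul_assoc, ← hP]; exact h⟩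
  · rintro ⟨X, rfl⟩
    rw [Matrix.mul_assoc, Matrix.mul_sub, Matrix.mul_one, hSP, sub_self, Matrix.mul_zero]

/-- In coordinates in which `S` is the diagonal projector `D`, the weighted norm of the TLS problem
is the Frobenius norm. -/
theorem frobNorm_mul_pinv_sqrt {S : Matrix ι ι ℝ} (hS : S.PosSemidef) {M M' : Matrix ι ι ℝ}
    {D : ι → ℝ} (hM : M * M' = 1) (hD : ∀ i, D i = 0 ∨ D i = 1)
    (hSD : M.transpose * S * M = diagonal D) (X : Matrix p ι ℝ) :
    frobNorm (X * S * pinv (CFC.sqrt S)) = frobNorm (X * S * M) := by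
  set R := CFC.sqrt S with hR
  have hRR : R * R = S := CFC.sqrt_mul_sqrt_self S hS.nonneg
  have hRt : R.transpose = R := by
    have h : R.IsHermitian := (CFC.sqrt_nonneg S).posSemidef.isHermitian
    rw [← conjTranspose_eq_transpose_of_trivial]
    exact h
  obtain ⟨h1, h2, h3, h4⟩ := pinv_isPinv R
  set Q := pinv R with hQ
  clear_value Q R
  have hW : (R * M).transpose * (R * M) = diagonal D := by
    rw [← hSD, ← hRR, transpose_mul, hRt]
    simp only [Matrix.mul_assoc]
  have hDD : diagonal D * diagonal D = diagonal D := by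
    rw [diagonal_mul_diagonal]
    congr 1
    funext i
    rcases hD i with h | h <;> simp [h]
  have hWD : R * M * diagonal D = R * M := by
    have : R * M - R * M * diagonal D = 0 := by
      apply trace_transpose_mul_self_eq_zero
      have e : (R * M - R * M * diagonal D).transpose * (R * M - R * M * diagonal D) = 0 := by
        have e1 : R * M - R * M * diagonal D = R * M * (1 - diagonal D) := by
          rw [Matrix.mul_sub, Matrix.mul_one]
        rw [e1, transpose_mul (R * M), Matrix.mul_assoc, ← Matrix.mul_assoc (R * M).transpose, hW,
          Matrix.mul_sub, Matrix.mul_one, hDD, sub_self, Matrix.mul_zero]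
      rw [e, trace_zero]
    exact (sub_eq_zero.mp this).symm
  have hWWR : R * M * (R * M).transpose * R = R := by
    have : R * M * (R * M).transpose * (R * M) = R * M := by
      rw [Matrix.mul_assoc, hW, hWD]
    calc R * M * (R * M).transpose * R
        = R * M * (R * M).transpose * (R * M) * M' := by
          rw [Matrix.mul_assoc _ (R * M) M', Matrix.mul_assoc R M M', hM, Matrix.mul_one]
      _ = R := by rw [this, Matrix.mul_assoc, hM, Matrix.mul_one]
  -- Both sides are symmetric, have their columns in the column space of `R`, and fix `R` under left
  -- multiplication; hence both are the orthogonal projector onto that space.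
  have hWW : R * M * (R * M).transpose = R * Q := by
    have e1 : R * M * (R * M).transpose * (R * Q) = R * Q := by
      rw [← Matrix.mul_assoc, hWWR]
    have e2 : R * Q * (R * M * (R * M).transpose) = R * M * (R * M).transpose := by
      rw [← Matrix.mul_assoc, ← Matrix.mul_assoc, h1]
    have e3 := congrArg transpose e2
    rw [transpose_mul, h3, transpose_mul (R * M), transpose_transpose, e1] at e3
    exact e3.symm
  have hΔ : X * S * Q * R = X * S := by
    rw [← hRR]
    calc X * (R * R) * Q * R = X * R * (R * Q * R) := by simp only [Matrix.mul_assoc]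
      _ = X * (R * R) := by rw [h1, Matrix.mul_assoc]
  have key : (X * S * M) * (X * S * M).transpose = (X * S * Q) * (X * S * Q).transpose := by
    have e : X * S * M = X * S * Q * (R * M) := by
      rw [← Matrix.mul_assoc, hΔ]
    have e' : X * S * Q * (R * Q) = X * S * Q := by
      rw [Matrix.mul_assoc (X * S), ← Matrix.mul_assoc Q, h2]
    rw [e, transpose_mul (X * S * Q), Matrix.mul_assoc (X * S * Q), ← Matrix.mul_assoc (R * M),
      hWW, ← Matrix.mul_assoc, e']
  rw [frobNorm_eq_sqrt_trace, frobNorm_eq_sqrt_trace, trace_mul_comm, ← key, trace_mul_comm]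

theorem sum_mul_sq_eq_of_diagonal {q : Type*} [Fintype q] {A : Matrix q ι ℝ} {μ : ι → ℝ}
    (hA : A.transpose * A = diagonal μ) (z : ι → ℝ) :
    (A *ᵥ z) ⬝ᵥ (A *ᵥ z) = ∑ i, μ i * z i ^ 2 := by
  rw [dotProduct_mulVec, ← mulVec_transpose, mulVec_mulVec, hA]
  simp only [dotProduct, mulVec_diagonal]
  exact Finset.sum_congr rfl fun i _ => by ring

end Reduction

/-! ### Well-posedness from the signature of a quadratic form -/

section Deterministic

open Matrix

variable {m n d : ℕ}

/-- If the quadratic form `‖C v‖² - τ vᵀ S v` is negative definite on the column space of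
`(X₀; -I)` and positive definite on `ℝⁿ × 0`, the TLS problem is well posed. -/
theorem wellPosed_of_quadratic_forms {S : Matrix (Fin n ⊕ Fin d) (Fin n ⊕ Fin d) ℝ}
    (hS : S.PosSemidef) (X₀ : Matrix (Fin n) (Fin d) ℝ) (C : Matrix (Fin m) (Fin n ⊕ Fin d) ℝ)
    {τ : ℝ} (hτ : 0 ≤ τ)
    (hneg : ∀ v : Fin n ⊕ Fin d → ℝ, v ≠ 0 → (∀ i, v (Sum.inl i) + (X₀ *ᵥ (v ∘ Sum.inr)) i = 0) →
      (C *ᵥ v) ⬝ᵥ (C *ᵥ v) < τ * (v ⬝ᵥ S *ᵥ v))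
    (hpos : ∀ v : Fin n ⊕ Fin d → ℝ, v ≠ 0 → (∀ j, v (Sum.inr j) = 0) →
      τ * (v ⬝ᵥ S *ᵥ v) < (C *ᵥ v) ⬝ᵥ (C *ᵥ v))
    (hker : ∀ v, v ≠ 0 → S *ᵥ v = 0 → C *ᵥ v ≠ 0) :
    AttainedFullRank S C ∧ UniqueSolution S C ∧ UniqueEstimate S C := by
  have hSt : S.transpose = S := by
    rw [← conjTranspose_eq_transpose_of_trivial]; exact hS.isHermitian
  have hG : (C.transpose * C).PosSemidef := by
    rw [← conjTranspose_eq_transpose_of_trivial]; exact posSemidef_conjTranspose_mul_self C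
  have hGv : ∀ v, v ⬝ᵥ (C.transpose * C) *ᵥ v = (C *ᵥ v) ⬝ᵥ (C *ᵥ v) := by
    intro v
    rw [← mulVec_mulVec, dotProduct_mulVec, vecMul_transpose]
  have hSG : (S + C.transpose * C).PosDef := by
    refine posDef_iff_dotProduct_mulVec.mpr ⟨hS.isHermitian.add hG.isHermitian, fun {v} hv => ?_⟩
    have hS0 := hS.dotProduct_mulVec_nonneg v
    have hC0 : 0 ≤ (C *ᵥ v) ⬝ᵥ (C *ᵥ v) :=
      Finset.sum_nonneg fun i _ => mul_self_nonneg _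
    rw [star_trivial] at hS0 ⊢
    rw [add_mulVec, dotProduct_add, hGv]
    rcases hS0.lt_or_eq with h | h
    · linarith
    · have h1 : S *ᵥ v = 0 := by
        apply (hS.dotProduct_mulVec_zero_iff v).mp
        rw [star_trivial]; exact h.symm
      have h2 := hker v hv h1
      have h3 : (C *ᵥ v) ⬝ᵥ (C *ᵥ v) ≠ 0 := fun h => h2 (dotProduct_self_eq_zero.mp h)
      rcases hC0.lt_or_eq with h' | h'
      · linarith
      · exact absurd h'.symm h3
  obtain ⟨M, M', D, μ, hM, hM', hD, hμ, hSD, hGD⟩ := exists_simultaneous_diagonalization hS hG hSG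
  have hCM : (C * M).transpose * (C * M) = diagonal μ := by
    rw [← hGD, transpose_mul]; simp only [Matrix.mul_assoc]
  have hCz : ∀ z, (C *ᵥ (M *ᵥ z)) ⬝ᵥ (C *ᵥ (M *ᵥ z)) = ∑ i, μ i * z i ^ 2 := by
    intro z
    rw [mulVec_mulVec, sum_mul_sq_eq_of_diagonal hCM]
  have hSz : ∀ z, (M *ᵥ z) ⬝ᵥ S *ᵥ (M *ᵥ z) = ∑ i, D i * z i ^ 2 := by
    intro z
    have : (M *ᵥ z) ⬝ᵥ S *ᵥ (M *ᵥ z) = z ⬝ᵥ (M.transpose * S * M) *ᵥ z := by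
      rw [← mulVec_mulVec, ← mulVec_mulVec, dotProduct_mulVec z M.transpose, vecMul_transpose]
    rw [this, hSD]
    simp only [dotProduct, mulVec_diagonal]
    exact Finset.sum_congr rfl fun i _ => by ring
  have hM0 : ∀ z, M *ᵥ z = 0 → z = 0 := by
    intro z hz
    have : M' *ᵥ (M *ᵥ z) = 0 := by rw [hz, mulVec_zero]
    rwa [mulVec_mulVec, hM', one_mulVec] at this
  -- the signature of the form
  let Lr : (Fin n ⊕ Fin d → ℝ) →ₗ[ℝ] (Fin d → ℝ) :=
    LinearMap.funLeft ℝ ℝ Sum.inr ∘ₗ M.mulVecLin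
  let Ll : (Fin n ⊕ Fin d → ℝ) →ₗ[ℝ] (Fin n → ℝ) :=
    LinearMap.funLeft ℝ ℝ Sum.inl ∘ₗ M.mulVecLin + X₀.mulVecLin ∘ₗ Lr
  have hLr : ∀ z j, Lr z j = (M *ᵥ z) (Sum.inr j) := fun _ _ => rfl
  have hLl : ∀ z i, Ll z i = (M *ᵥ z) (Sum.inl i) + (X₀ *ᵥ ((M *ᵥ z) ∘ Sum.inr)) i :=
    fun _ _ => rfl
  have hform : ∀ (f : Fin n ⊕ Fin d → Prop) (z : Fin n ⊕ Fin d → ℝ), (∀ i, ¬ f i → z i = 0) →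
      (∀ i, f i → 0 ≤ (μ i - τ * D i) * z i ^ 2) →
        τ * ((M *ᵥ z) ⬝ᵥ S *ᵥ (M *ᵥ z)) ≤ (C *ᵥ (M *ᵥ z)) ⬝ᵥ (C *ᵥ (M *ᵥ z)) := by
    intro f z hz h
    rw [hCz, hSz, Finset.mul_sum]
    refine Finset.sum_le_sum fun i _ => ?_
    by_cases hi : f i
    · have := h i hi; linarith
    · rw [hz i hi]; simp
  have hform' : ∀ (f : Fin n ⊕ Fin d → Prop) (z : Fin n ⊕ Fin d → ℝ), (∀ i, ¬ f i → z i = 0) →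
      (∀ i, f i → (μ i - τ * D i) * z i ^ 2 ≤ 0) →
        (C *ᵥ (M *ᵥ z)) ⬝ᵥ (C *ᵥ (M *ᵥ z)) ≤ τ * ((M *ᵥ z) ⬝ᵥ S *ᵥ (M *ᵥ z)) := by
    intro f z hz h
    rw [hCz, hSz, Finset.mul_sum]
    refine Finset.sum_le_sum fun i _ => ?_
    by_cases hi : f i
    · have := h i hi; linarith
    · rw [hz i hi]; simp
  set J₀ := Finset.univ.filter fun i => μ i ≤ τ * D i with hJ₀
  set J := Finset.univ.filter fun i => μ i < τ * D i with hJ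
  -- On the span of the directions in `J₀` the form is nonpositive, while on `ℝⁿ × 0`, the kernel of
  -- the last `d` coordinates, it is positive definite; so the two meet only in `0`.
  have hLrinj : ∀ z, (∀ i, i ∉ J₀ → z i = 0) → Lr z = 0 → z = 0 := by
    intro z hz h0
    by_contra hne
    have h1 := hpos (M *ᵥ z) (fun h => hne (hM0 z h)) fun j => by rw [← hLr, h0]; rfl
    have h2 := hform' (· ∈ J₀) z hz fun i hi => by
      have : μ i ≤ τ * D i := by simpa [hJ₀] using hi
      exact mul_nonpos_of_nonpos_of_nonneg (by linarith) (sq_nonneg _)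
    linarith
  -- Dually, the form is nonnegative on the span of the complement of `J` and negative definite on
  -- the kernel of `(I, X₀)`.
  have hLlinj : ∀ z, (∀ i, i ∉ Jᶜ → z i = 0) → Ll z = 0 → z = 0 := by
    intro z hz h0
    by_contra hne
    have h1 := hneg (M *ᵥ z) (fun h => hne (hM0 z h)) fun j => by rw [← hLl, h0]; rfl
    have h2 := hform (· ∈ Jᶜ) z hz fun i hi => by
      have : τ * D i ≤ μ i := by simpa [hJ] using hi
      exact mul_nonneg (by linarith) (sq_nonneg _)
    linarith
  have hc1 : J₀.card ≤ d := (card_le_of_injOn_support J₀ Lr hLrinj).1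
  have hc2 : Jᶜ.card ≤ n := (card_le_of_injOn_support Jᶜ Ll hLlinj).1
  have hsub : J ⊆ J₀ := fun i hi => by
    have : μ i < τ * D i := by simpa [hJ] using hi
    simpa [hJ₀] using this.le
  have hcard : Jᶜ.card + J.card = n + d := by
    rw [Finset.card_compl_add_card]; simp
  -- The bounds `d` and `n` add up to the whole dimension, so both are attained and no index gives
  -- `μ i = τ D i`.
  have hJJ : J = J₀ := Finset.eq_of_subset_of_card_le hsub (by omega)
  have hJd : J.card = d := by
    have := Finset.card_le_card hsub
    omega
  have hlowD : ∀ i ∈ J, D i = 1 := by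
    intro i hi
    have h : μ i < τ * D i := by simpa [hJ] using hi
    rcases hD i with h0 | h0
    · rw [h0, mul_zero] at h
      exact absurd h (not_lt.mpr (hμ i))
    · exact h0
  have hlow : ∀ i ∈ J, μ i < τ := by
    intro i hi
    have h : μ i < τ * D i := by simpa [hJ] using hi
    rwa [hlowD i hi, mul_one] at h
  have hhigh : ∀ i, i ∉ J → τ * D i < μ i := by
    intro i hi
    rw [hJJ] at hi
    simpa [hJ₀] using hi
  have hμpos : ∀ i, i ∉ J → 0 < μ i := by
    intro i hi
    refine lt_of_le_of_lt ?_ (hhigh i hi)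
    rcases hD i with h0 | h0 <;> simp [h0, hτ]
  -- the minimizer
  set DJ : Matrix (Fin n ⊕ Fin d) (Fin n ⊕ Fin d) ℝ :=
    diagonal (fun i => if i ∈ J then (1 : ℝ) else 0) with hDJ
  have hDJD : DJ * diagonal D = DJ := by
    rw [hDJ, diagonal_mul_diagonal]
    congr 1
    funext i
    split_ifs with h
    · rw [hlowD i h, one_mul]
    · rw [zero_mul]
  have hDM : diagonal D * M' = M.transpose * S := by
    rw [← hSD, Matrix.mul_assoc, hM, Matrix.mul_one]
  -- In the coordinates `M` this perturbation removes exactly the columns of `C M` indexed by `J`.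
  set Δ₀ := C * M * DJ * M' with hΔ₀
  have hΔ₀M : Δ₀ * M = C * M * DJ := by
    rw [hΔ₀, Matrix.mul_assoc, hM', Matrix.mul_one]
  have hΔ₀S : Δ₀ = (C * M * DJ * M.transpose) * S := by
    rw [Matrix.mul_assoc _ M.transpose, ← hDM, ← Matrix.mul_assoc, Matrix.mul_assoc (C * M), hDJD]
  have hres : (C - Δ₀) * M = C * M * (1 - DJ) := by
    rw [Matrix.sub_mul, hΔ₀M, Matrix.mul_sub, Matrix.mul_one]
  have h1DJ : 1 - DJ = diagonal (fun i => if i ∈ J then (0 : ℝ) else 1) := by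
    rw [hDJ, ← diagonal_one, diagonal_sub]
    congr 1
    funext i
    split_ifs <;> simp
  have hfeas : Feasible S C Δ₀ := by
    refine ⟨(mul_one_sub_colProj_eq_zero_iff hSt).mpr ⟨_, hΔ₀S⟩, ?_⟩
    have e : C - Δ₀ = C * M * (1 - DJ) * M' := by
      rw [← hres, Matrix.mul_assoc, hM, Matrix.mul_one]
    rw [e]
    refine (rank_mul_le_left _ _).trans ((rank_mul_le_right _ _).trans ?_)
    rw [h1DJ, rank_diagonal, Fintype.card_subtype]
    have : (Finset.univ.filter fun i => (if i ∈ J then (0 : ℝ) else 1) ≠ 0) = Jᶜ := by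
      ext i
      by_cases h : i ∈ J <;> simp [h]
    rw [this]
    exact hc2
  have hobj : ∀ Δ, Feasible S C Δ → objective S Δ = frobNorm (Δ * M) := by
    intro Δ hΔ
    obtain ⟨X, rfl⟩ := (mul_one_sub_colProj_eq_zero_iff hSt).mp hΔ.1
    exact frobNorm_mul_pinv_sqrt hS hM hD hSD X
  have hobj₀ : objective S Δ₀ = √(∑ i ∈ J, μ i) := by
    rw [hobj Δ₀ hfeas, frobNorm_eq_sqrt_trace, hΔ₀M, transpose_mul, Matrix.mul_assoc,
      ← Matrix.mul_assoc (C * M).transpose, hCM, hDJ, diagonal_transpose, diagonal_mul_diagonal,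
      diagonal_mul_diagonal, trace_diagonal]
    congr 1
    simp
  have hkey : ∀ Δ, Feasible S C Δ → √(∑ i ∈ J, μ i) ≤ objective S Δ ∧
      (objective S Δ = √(∑ i ∈ J, μ i) → Δ = Δ₀) := by
    intro Δ hΔ
    obtain ⟨X, hX⟩ := (mul_one_sub_colProj_eq_zero_iff hSt).mp hΔ.1
    obtain ⟨Z₀, hZ₀, hZr⟩ := exists_mul_eq_zero_of_rank_le hΔ.2
    -- A kernel vector of `C - Δ` lying in `ker S` is killed by `Δ`, hence by `C`, against `hker`.
    -- So `Z₀` can be normalized to be orthonormal for `S`.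
    have hPD : (Z₀.transpose * S * Z₀).PosDef := by
      refine posDef_iff_dotProduct_mulVec.mpr ⟨?_, fun {x} hx => ?_⟩
      · rw [← conjTranspose_eq_transpose_of_trivial]
        exact isHermitian_conjTranspose_mul_mul Z₀ hS.isHermitian
      · have hv : Z₀ *ᵥ x ≠ 0 := fun h => hx (eq_zero_of_mulVec_eq_zero_of_rank hZr h)
        have e : x ⬝ᵥ (Z₀.transpose * S * Z₀) *ᵥ x = (Z₀ *ᵥ x) ⬝ᵥ S *ᵥ (Z₀ *ᵥ x) := by
          rw [← mulVec_mulVec, ← mulVec_mulVec, dotProduct_mulVec x Z₀.transpose, vecMul_transpose]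
        have h0 := hS.dotProduct_mulVec_nonneg (Z₀ *ᵥ x)
        rw [star_trivial] at h0 ⊢
        rw [e]
        refine lt_of_le_of_ne h0 fun h => ?_
        have h1 : S *ᵥ (Z₀ *ᵥ x) = 0 := by
          apply (hS.dotProduct_mulVec_zero_iff _).mp
          rw [star_trivial]; exact h.symm
        apply hker _ hv h1
        have h2 : (C - Δ) *ᵥ (Z₀ *ᵥ x) = 0 := by rw [mulVec_mulVec, hZ₀, zero_mulVec]
        rw [sub_mulVec, hX, ← mulVec_mulVec, h1, mulVec_zero, sub_zero] at h2
        exact h2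
    obtain ⟨B, B', hB, hB', hBB⟩ := exists_transpose_mul_self_of_posDef hPD
    have hZker : (C * M - Δ * M) * (M' * Z₀ * B') = 0 := by
      have e : (C * M - Δ * M) * (M' * Z₀ * B') = (C - Δ) * (M * M') * Z₀ * B' := by
        rw [← Matrix.sub_mul]; simp only [Matrix.mul_assoc]
      rw [e, hM, Matrix.mul_one, hZ₀, Matrix.zero_mul]
    have hZn : (M' * Z₀ * B').transpose * diagonal D * (M' * Z₀ * B') = 1 := by
      have e : (M' * Z₀ * B').transpose * diagonal D * (M' * Z₀ * B')
          = B'.transpose * (Z₀.transpose * ((M * M').transpose * S * (M * M')) * Z₀) * B' := by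
        rw [← hSD]
        simp only [transpose_mul, Matrix.mul_assoc]
      rw [e, hM, transpose_one, Matrix.one_mul, Matrix.mul_one, hBB]
      calc B'.transpose * (B.transpose * B) * B' = (B * B').transpose * (B * B') := by
            simp only [transpose_mul, Matrix.mul_assoc]
        _ = 1 := by rw [hB, transpose_one, Matrix.one_mul]
    have hΔD : Δ * M * diagonal D = Δ * M := by
      have e : S * M = M'.transpose * diagonal D := by
        rw [← hSD]
        calc S * M = (M * M').transpose * S * M := by rw [hM, transpose_one, Matrix.one_mul]
          _ = _ := by simp only [transpose_mul, Matrix.mul_assoc]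
      have hDD : diagonal D * diagonal D = diagonal D := by
        rw [diagonal_mul_diagonal]
        congr 1
        funext i
        rcases hD i with h | h <;> simp [h]
      rw [hX, Matrix.mul_assoc X, e, Matrix.mul_assoc, Matrix.mul_assoc, hDD]
    obtain ⟨hle, heq⟩ := trace_le_of_kernel hD hCM hJd hlowD hlow hhigh hΔD hZker hZn
    rw [hobj Δ hΔ, frobNorm_eq_sqrt_trace]
    refine ⟨Real.sqrt_le_sqrt hle, fun h => ?_⟩
    have h1 := heq ((Real.sqrt_inj (trace_transpose_mul_self_nonneg _)
      (Finset.sum_nonneg fun i _ => hμ i)).mp h)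
    rw [hΔ₀, ← h1, Matrix.mul_assoc, hM, Matrix.mul_one]
  have hsol : IsSolution S C Δ₀ := ⟨hfeas, fun Δ hΔ => by rw [hobj₀]; exact (hkey Δ hΔ).1⟩
  have huniq : ∀ Δ, IsSolution S C Δ → Δ = Δ₀ := by
    intro Δ hΔ
    refine (hkey Δ hΔ.1).2 (le_antisymm ?_ (hkey Δ hΔ.1).1)
    rw [← hobj₀]
    exact hΔ.2 Δ₀ hfeas
  -- the kernel of the corrected matrix
  have hkernel : ∀ z, (C - Δ₀) *ᵥ (M *ᵥ z) = 0 ↔ ∀ i, i ∉ J → z i = 0 := by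
    intro z
    have e : (C - Δ₀) *ᵥ (M *ᵥ z) = (C * M) *ᵥ ((1 - DJ) *ᵥ z) := by
      rw [mulVec_mulVec, hres, mulVec_mulVec]
    have e' : ∀ i, ((1 - DJ) *ᵥ z) i = if i ∈ J then 0 else z i := by
      intro i
      rw [h1DJ, mulVec_diagonal]
      split_ifs <;> simp
    rw [e]
    constructor
    · intro h i hi
      have h1 := sum_mul_sq_eq_of_diagonal hCM ((1 - DJ) *ᵥ z)
      rw [h, dotProduct_zero] at h1
      have h2 := (Finset.sum_eq_zero_iff_of_nonneg
        fun i _ => mul_nonneg (hμ i) (sq_nonneg _)).mp h1.symm i (Finset.mem_univ i)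
      rw [e', if_neg hi] at h2
      rcases mul_eq_zero.mp h2 with h3 | h3
      · exact absurd h3 (hμpos i hi).ne'
      · exact pow_eq_zero_iff two_ne_zero |>.mp h3
    · intro h
      have : (1 - DJ) *ᵥ z = 0 := by
        funext i
        rw [e']
        split_ifs with hi
        · rfl
        · exact h i hi
      rw [this, mulVec_zero]
  have hMM' : ∀ v, M *ᵥ (M' *ᵥ v) = v := fun v => by rw [mulVec_mulVec, hM, one_mulVec]
  refine ⟨⟨⟨Δ₀, hsol⟩, fun Δ hΔ => ?_⟩, ⟨Δ₀, hsol, huniq⟩, fun Δ hΔ => ?_⟩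
  · exact exists_mul_eq_zero_of_rank_le hΔ.2
  · rw [huniq Δ hΔ]
    have hsurj := (card_le_of_injOn_support J Lr (hJJ ▸ hLrinj)).2 hJd
    -- Column `j` of the estimate is read from the unique kernel vector whose last `d` coordinates
    -- are those of column `j` of `-I`.
    choose z hz hLz using fun j : Fin d => hsurj (-(Pi.single j 1))
    refine ⟨Matrix.of fun i j => (M *ᵥ z j) (Sum.inl i), ?_, fun X hX => ?_⟩
    · have hcol : ∀ j, (fun i => augmented (Matrix.of fun i j => (M *ᵥ z j) (Sum.inl i)) i j)
          = M *ᵥ z j := by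
        intro j
        funext i
        rcases i with i | i
        · simp [augmented]
        · rw [← hLr, hLz]
          simp [augmented, Matrix.one_apply, Pi.single_apply]
      ext i j
      have h1 := congrFun ((hkernel (z j)).mpr (hz j)) i
      rw [← hcol j] at h1
      simpa [mul_apply, mulVec, dotProduct] using h1
    · ext i j
      have hcolX : (C - Δ₀) *ᵥ (fun i => augmented X i j) = 0 := by
        funext k
        have := congrFun (congrFun hX k) j
        simpa [mul_apply, mulVec, dotProduct] using this
      set u : Fin n ⊕ Fin d → ℝ := (fun i => augmented X i j) - M *ᵥ z j with hu
      have hu0 : (C - Δ₀) *ᵥ (M *ᵥ (M' *ᵥ u)) = 0 := by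
        rw [hMM', hu, mulVec_sub, hcolX, (hkernel (z j)).mpr (hz j), sub_zero]
      have h2 := hLrinj (M' *ᵥ u) (hJJ ▸ (hkernel _).mp hu0) (by
        funext k
        rw [hLr, hMM', hu, Pi.sub_apply, ← hLr, hLz]
        simp [augmented, Matrix.one_apply, Pi.single_apply])
      have h3 : u = 0 := by rw [← hMM' u, h2, mulVec_zero]
      have h4 := congrFun h3 (Sum.inl i)
      rw [hu, Pi.sub_apply, Pi.zero_apply, sub_eq_zero] at h4
      simpa [augmented] using h4

end Deterministic

end TLS

namespace TLS

/-! ### Elementary bounds for quadratic forms -/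

section QuadraticBounds

open Matrix

theorem dotProduct_self_nonneg {q : Type*} [Fintype q] (x : q → ℝ) : 0 ≤ x ⬝ᵥ x :=
  Finset.sum_nonneg fun _ _ => mul_self_nonneg _

theorem dotProduct_self_pos {q : Type*} [Fintype q] {x : q → ℝ} (hx : x ≠ 0) : 0 < x ⬝ᵥ x :=
  (dotProduct_self_nonneg x).lt_of_ne fun h => hx (dotProduct_self_eq_zero.mp h.symm)

theorem dotProduct_sq_le {q : Type*} [Fintype q] (x y : q → ℝ) :
    (x ⬝ᵥ y) ^ 2 ≤ (x ⬝ᵥ x) * (y ⬝ᵥ y) := by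
  have := Finset.sum_mul_sq_le_sq_mul_sq Finset.univ x y
  simpa only [dotProduct, sq] using this

theorem mulVec_dotProduct_mulVec_le {p q : Type*} [Fintype p] [Fintype q] (A : Matrix p q ℝ)
    (x : q → ℝ) : (A *ᵥ x) ⬝ᵥ (A *ᵥ x) ≤ (∑ i, ∑ j, A i j ^ 2) * (x ⬝ᵥ x) := by
  rw [Finset.sum_mul]
  refine Finset.sum_le_sum fun i _ => ?_
  have := dotProduct_sq_le (A i) x
  rw [← sq]
  refine this.trans_eq ?_
  simp only [dotProduct, sq]

theorem exists_pos_mul_le_of_posDef {q : Type*} [Fintype q] [DecidableEq q] {A : Matrix q q ℝ}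
    (hA : A.PosDef) : ∃ c : ℝ, 0 < c ∧ ∀ v : q → ℝ, c * (v ⬝ᵥ v) ≤ v ⬝ᵥ A *ᵥ v := by
  obtain ⟨B, B', hB, hB', hBB⟩ := exists_transpose_mul_self_of_posDef hA
  have hk : 0 < (∑ i, ∑ j, B' i j ^ 2) + 1 := by positivity
  refine ⟨((∑ i, ∑ j, B' i j ^ 2) + 1)⁻¹, inv_pos.mpr hk, fun v => ?_⟩
  have h1 := mulVec_dotProduct_mulVec_le B' (B *ᵥ v)
  rw [mulVec_mulVec, hB', one_mulVec] at h1
  have h2 : v ⬝ᵥ A *ᵥ v = (B *ᵥ v) ⬝ᵥ (B *ᵥ v) := by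
    rw [hBB, ← mulVec_mulVec, dotProduct_mulVec, vecMul_transpose]
  rw [h2, inv_mul_le_iff₀ hk]
  nlinarith [dotProduct_self_nonneg (B *ᵥ v)]

theorem exists_le_mul_of_posSemidef {q : Type*} [Fintype q] [DecidableEq q] {A : Matrix q q ℝ}
    (hA : A.PosSemidef) : ∃ K : ℝ, 0 ≤ K ∧ ∀ v : q → ℝ, v ⬝ᵥ A *ᵥ v ≤ K * (v ⬝ᵥ v) := by
  refine ⟨∑ i, ∑ j, CFC.sqrt A i j ^ 2, by positivity, fun v => ?_⟩
  have hs : CFC.sqrt A * CFC.sqrt A = A := CFC.sqrt_mul_sqrt_self A hA.nonneg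
  have ht : (CFC.sqrt A).transpose = CFC.sqrt A := by
    have h : (CFC.sqrt A).IsHermitian := (CFC.sqrt_nonneg A).posSemidef.isHermitian
    rw [← conjTranspose_eq_transpose_of_trivial]
    exact h
  refine le_trans (le_of_eq ?_) (mulVec_dotProduct_mulVec_le (CFC.sqrt A) v)
  nth_rewrite 1 [← hs]
  rw [← mulVec_mulVec, dotProduct_mulVec, ← mulVec_transpose, ht]

end QuadraticBounds

/-! ### The smallest eigenvalue of the Gram matrix -/

section SmallestEigenvalue

open Matrix

variable {p q : Type*} [Fintype p] [Fintype q] [DecidableEq q]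

theorem exists_diagonalization_gram (A : Matrix p q ℝ) :
    ∃ U : Matrix q q ℝ, U.transpose * U = diagonal (fun _ => (1 : ℝ)) ∧ U * U.transpose = 1 ∧
      (A * U).transpose * (A * U)
        = diagonal (isHermitian_conjTranspose_mul_self A).eigenvalues := by
  set hA := isHermitian_conjTranspose_mul_self A
  have hUU : (hA.eigenvectorUnitary : Matrix q q ℝ).transpose
      * (hA.eigenvectorUnitary : Matrix q q ℝ) = 1 := by
    have := Matrix.mem_unitaryGroup_iff'.mp (hA.eigenvectorUnitary).2
    rwa [star_eq_conjTranspose, conjTranspose_eq_transpose_of_trivial] at this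
  refine ⟨(hA.eigenvectorUnitary : Matrix q q ℝ), ?_, mul_eq_one_comm.mp hUU, ?_⟩
  · rw [hUU, diagonal_one]
  · have h := hA.conjStarAlgAut_star_eigenvectorUnitary
    rw [Unitary.conjStarAlgAut_apply] at h
    have h' : (hA.eigenvectorUnitary : Matrix q q ℝ).transpose * (A.transpose * A)
        * (hA.eigenvectorUnitary : Matrix q q ℝ) = diagonal hA.eigenvalues := by
      simpa [star_eq_conjTranspose, conjTranspose_eq_transpose_of_trivial] using h
    rw [← h', transpose_mul]
    simp only [Matrix.mul_assoc]

theorem lambdaMinGram_mul_le (A : Matrix p q ℝ) (x : q → ℝ) :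
    lambdaMinGram A * (x ⬝ᵥ x) ≤ (A *ᵥ x) ⬝ᵥ (A *ᵥ x) := by
  obtain ⟨U, hU, hU', hAU⟩ := exists_diagonalization_gram A
  have hx : U *ᵥ (U.transpose *ᵥ x) = x := by rw [mulVec_mulVec, hU', one_mulVec]
  have h1 := sum_mul_sq_eq_of_diagonal hU (U.transpose *ᵥ x)
  have h2 := sum_mul_sq_eq_of_diagonal hAU (U.transpose *ᵥ x)
  rw [← mulVec_mulVec, hx] at h2
  rw [hx] at h1
  rw [h1, h2, Finset.mul_sum]
  refine Finset.sum_le_sum fun i _ => ?_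
  rw [one_mul]
  exact mul_le_mul_of_nonneg_right (ciInf_le (Set.finite_range _).bddBelow i) (sq_nonneg _)

theorem le_lambdaMinGram [Nonempty q] {A : Matrix p q ℝ} {l : ℝ}
    (h : ∀ x : q → ℝ, l * (x ⬝ᵥ x) ≤ (A *ᵥ x) ⬝ᵥ (A *ᵥ x)) : l ≤ lambdaMinGram A := by
  obtain ⟨U, hU, hU', hAU⟩ := exists_diagonalization_gram A
  refine le_ciInf fun i => ?_
  have h0 := h (U *ᵥ Pi.single i 1)
  have h1 := sum_mul_sq_eq_of_diagonal hU (Pi.single i 1)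
  have h2 := sum_mul_sq_eq_of_diagonal hAU (Pi.single i 1)
  rw [← mulVec_mulVec] at h2
  rw [h1, h2] at h0
  simpa [Pi.single_apply] using h0

theorem posDef_gram_of_lambdaMinGram_pos {A : Matrix p q ℝ} (hA : 0 < lambdaMinGram A) :
    (A.transpose * A).PosDef := by
  refine posDef_iff_dotProduct_mulVec.mpr ⟨?_, fun {x} hx => ?_⟩
  · rw [← conjTranspose_eq_transpose_of_trivial]; exact isHermitian_conjTranspose_mul_self A
  · rw [star_trivial, ← mulVec_mulVec, dotProduct_mulVec, vecMul_transpose]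
    exact (mul_pos hA (dotProduct_self_pos hx)).trans_le (lambdaMinGram_mul_le A x)

/-- A matrix of full column rank has a factorization `U B` with orthonormal columns `U`. -/
theorem exists_orthonormal_factor {A : Matrix p q ℝ} (hA : 0 < lambdaMinGram A) :
    ∃ (U : Matrix p q ℝ) (B : Matrix q q ℝ), U.transpose * U = 1 ∧ A = U * B := by
  obtain ⟨B, B', hB, hB', hBB⟩ :=
    exists_transpose_mul_self_of_posDef (posDef_gram_of_lambdaMinGram_pos hA)
  refine ⟨A * B', B, ?_, by rw [Matrix.mul_assoc, hB', Matrix.mul_one]⟩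
  rw [transpose_mul, Matrix.mul_assoc, ← Matrix.mul_assoc A.transpose, hBB]
  calc B'.transpose * (B.transpose * B * B') = (B * B').transpose * (B * B') := by
        simp only [transpose_mul, Matrix.mul_assoc]
    _ = 1 := by rw [hB, transpose_one, Matrix.one_mul]

/-- A further row adds a square to `‖A₀ x‖²`. Monotonicity is what Kronecker's lemma and the
reduction of exponents `r ≥ 2` rely on. -/
theorem lambdaMinGram_trueA_mono {n : ℕ} (hn : 1 ≤ n) (a₀ : ℕ → Fin n → ℝ) :
    Monotone fun m => lambdaMinGram (trueA a₀ m) := by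
  have : Nonempty (Fin n) := ⟨⟨0, hn⟩⟩
  refine monotone_nat_of_le_succ fun m => le_lambdaMinGram fun x => ?_
  refine (lambdaMinGram_mul_le (trueA a₀ m) x).trans ?_
  simp only [dotProduct, mulVec, trueA, of_apply]
  rw [Fin.sum_univ_castSucc (n := m)]
  simp only [Fin.val_castSucc, Fin.val_last]
  exact le_add_of_nonneg_right (mul_self_nonneg _)

end SmallestEigenvalue

/-! ### From small errors to the definiteness conditions -/

section Perturbation

open Matrix

variable {n d : ℕ}

/-- The TLS problem is well posed if the sample covariance of the errors and their components along
the columns of `A₀` are close to their means, in the scale of `λ_min(A₀ᵀ A₀)`. -/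
theorem exists_wellPosed_of_perturbation {S : Matrix (Fin n ⊕ Fin d) (Fin n ⊕ Fin d) ℝ}
    (hS : S.PosSemidef) {X₀ : Matrix (Fin n) (Fin d) ℝ} (hrank : (S * augmented X₀).rank = d) :
    ∃ ε : ℝ, 0 < ε ∧ ∀ (m : ℕ) (A₀ U : Matrix (Fin m) (Fin n) ℝ) (B : Matrix (Fin n) (Fin n) ℝ)
      (E : Matrix (Fin m) (Fin n ⊕ Fin d) ℝ), 0 < lambdaMinGram A₀ → U.transpose * U = 1 →
      A₀ = U * B → (∀ j k, |∑ i, E i j * E i k - m * S j k| ≤ ε * lambdaMinGram A₀) →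
      (∀ l j, ((U.transpose * E) l j) ^ 2 ≤ ε * lambdaMinGram A₀) →
      AttainedFullRank S (fromCols A₀ (A₀ * X₀) + E) ∧
        UniqueSolution S (fromCols A₀ (A₀ * X₀) + E) ∧
        UniqueEstimate S (fromCols A₀ (A₀ * X₀) + E) := by
  set T : Matrix (Fin n) (Fin n ⊕ Fin d) ℝ := fromCols 1 X₀ with hT
  have hTv : ∀ v, T *ᵥ v = v ∘ Sum.inl + X₀ *ᵥ (v ∘ Sum.inr) := by
    intro v
    rw [hT, fromCols_mulVec, one_mulVec]
  have hSS : ∀ v, v ⬝ᵥ S *ᵥ v = 0 → S *ᵥ v = 0 := by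
    intro v h
    apply (hS.dotProduct_mulVec_zero_iff v).mp
    rw [star_trivial]; exact h
  have hS0 : ∀ v, 0 ≤ v ⬝ᵥ S *ᵥ v := by
    intro v
    have := hS.dotProduct_mulVec_nonneg v
    rwa [star_trivial] at this
  have hTT : ∀ v, v ⬝ᵥ (T.transpose * T) *ᵥ v = (T *ᵥ v) ⬝ᵥ (T *ᵥ v) := by
    intro v
    rw [← mulVec_mulVec, dotProduct_mulVec, vecMul_transpose]
  -- The kernel of `T` is the column space of `(X₀; -I)`, on which the rank hypothesis makes `S`
  -- injective. Hence `S` and `TᵀT` have no common kernel.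
  have hPD : (S + T.transpose * T).PosDef := by
    refine posDef_iff_dotProduct_mulVec.mpr ⟨hS.isHermitian.add ?_, fun {v} hv => ?_⟩
    · rw [← conjTranspose_eq_transpose_of_trivial]; exact isHermitian_conjTranspose_mul_self T
    · rw [star_trivial, add_mulVec, dotProduct_add, hTT]
      have h1 := hS0 v
      have h2 := dotProduct_self_nonneg (T *ᵥ v)
      refine lt_of_le_of_ne (add_nonneg h1 h2) fun h => hv ?_
      have h3 : S *ᵥ v = 0 := hSS v (by linarith)
      have h4 : T *ᵥ v = 0 := dotProduct_self_eq_zero.mp (by linarith)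
      have h5 : v = augmented X₀ *ᵥ (-(v ∘ Sum.inr)) := by
        rw [hTv] at h4
        funext i
        rcases i with i | i
        · have := congrFun h4 i
          simp only [augmented, fromRows_mulVec, mulVec_neg, Sum.elim_inl, Pi.neg_apply]
          simp only [Pi.add_apply, Pi.zero_apply, Function.comp_apply] at this
          linarith
        · simp [augmented, neg_mulVec]
      have h6 : -(v ∘ Sum.inr) = 0 := by
        apply eq_zero_of_mulVec_eq_zero_of_rank hrank
        rw [← mulVec_mulVec, ← h5, h3]
      rw [h5, h6, mulVec_zero]
  obtain ⟨c, hc, hcv⟩ := exists_pos_mul_le_of_posDef hPD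
  obtain ⟨K, hK, hKv⟩ := exists_le_mul_of_posSemidef hS
  -- `η` is small enough that `η λ vᵀ S v` costs at most a quarter of `λ ‖v‖²`; the summand `1`
  -- covers `K = 0`.
  set η : ℝ := 1 / (4 * (K + 1)) with hη
  have hη0 : 0 < η := by positivity
  have hηK : η * K ≤ 1 / 4 := by
    rw [hη, div_mul_eq_mul_div, div_le_div_iff₀ (by positivity) (by norm_num)]
    linarith
  -- `κ` is the total error allowed, relative to `λ ‖v‖²`. Its three bounds serve negativity on `ker
  -- T`, positivity on `ℝⁿ × 0`, and injectivity of `C` on `ker S`.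
  set κ : ℝ := min (η * c / 2) (min (1 / 8) (c / 8)) with hκ
  have hκ0 : 0 < κ := by positivity
  have hκ1 : κ ≤ η * c / 2 := min_le_left _ _
  have hκ2 : κ ≤ 1 / 8 := (min_le_right _ _).trans (min_le_left _ _)
  have hκ3 : κ ≤ c / 8 := (min_le_right _ _).trans (min_le_right _ _)
  set N : ℝ := (n : ℝ) + d with hN
  have hN0 : 0 ≤ N := by positivity
  have hnN : (n : ℝ) ≤ N := by simp [hN]
  -- The denominator collects the entrywise errors: `N` from the covariance term and `2 N²` from the
  -- cross term; the extra `1` keeps it positive.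
  refine ⟨κ / (2 * N * N + N + 1), by positivity, fun m A₀ U B E hl hU hA hW hL => ?_⟩
  set l := lambdaMinGram A₀ with hl_def
  set ε := κ / (2 * N * N + N + 1) with hε
  have hεκ : 2 * (N * N * (ε * l)) + N * (ε * l) ≤ κ * l := by
    have : ε * (2 * N * N + N + 1) = κ := by rw [hε]; field_simp
    have hε0 : 0 < ε := by positivity
    have : 0 ≤ ε * l := by positivity
    calc 2 * (N * N * (ε * l)) + N * (ε * l) ≤ (ε * (2 * N * N + N + 1)) * l := by nlinarith
      _ = κ * l := by rw [‹ε * (2 * N * N + N + 1) = κ›]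
  have hεl : 0 ≤ ε * l := by positivity
  -- the two error terms
  have herr : ∀ v, |(E *ᵥ v) ⬝ᵥ (E *ᵥ v) - m * (v ⬝ᵥ S *ᵥ v)| ≤ N * (ε * l) * (v ⬝ᵥ v) := by
    intro v
    set W : Matrix (Fin n ⊕ Fin d) (Fin n ⊕ Fin d) ℝ := E.transpose * E - (m : ℝ) • S with hWdef
    have e : (E *ᵥ v) ⬝ᵥ (E *ᵥ v) - m * (v ⬝ᵥ S *ᵥ v) = v ⬝ᵥ W *ᵥ v := by
      rw [hWdef, sub_mulVec, dotProduct_sub, smul_mulVec, dotProduct_smul, smul_eq_mul,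
        ← mulVec_mulVec, dotProduct_mulVec v E.transpose, vecMul_transpose]
    have hWe : ∀ j k, W j k ^ 2 ≤ (ε * l) ^ 2 := by
      intro j k
      have := hW j k
      have e' : W j k = ∑ i, E i j * E i k - m * S j k := by
        simp [hWdef, mul_apply]
      rw [e']
      exact sq_le_sq' (abs_le.mp this).1 (abs_le.mp this).2
    have hsum : ∑ j, ∑ k, W j k ^ 2 ≤ (N * (ε * l)) ^ 2 := by
      calc ∑ j, ∑ k, W j k ^ 2 ≤ ∑ _j : Fin n ⊕ Fin d, ∑ _k : Fin n ⊕ Fin d, (ε * l) ^ 2 :=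
            Finset.sum_le_sum fun j _ => Finset.sum_le_sum fun k _ => hWe j k
        _ = (N * (ε * l)) ^ 2 := by
            simp [hN]
            ring
    rw [e]
    refine abs_le_of_sq_le_sq ?_ (mul_nonneg (by positivity) (dotProduct_self_nonneg v))
    calc (v ⬝ᵥ W *ᵥ v) ^ 2 ≤ (v ⬝ᵥ v) * ((W *ᵥ v) ⬝ᵥ (W *ᵥ v)) := dotProduct_sq_le _ _
      _ ≤ (v ⬝ᵥ v) * ((∑ j, ∑ k, W j k ^ 2) * (v ⬝ᵥ v)) :=
          mul_le_mul_of_nonneg_left (mulVec_dotProduct_mulVec_le W v) (dotProduct_self_nonneg v)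
      _ ≤ (v ⬝ᵥ v) * ((N * (ε * l)) ^ 2 * (v ⬝ᵥ v)) := by
          have := dotProduct_self_nonneg v
          gcongr
      _ = (N * (ε * l) * (v ⬝ᵥ v)) ^ 2 := by ring
  have hcross : ∀ v, |2 * ((A₀ *ᵥ (T *ᵥ v)) ⬝ᵥ (E *ᵥ v))|
      ≤ 1 / 2 * ((A₀ *ᵥ (T *ᵥ v)) ⬝ᵥ (A₀ *ᵥ (T *ᵥ v))) + 2 * (N * N * (ε * l) * (v ⬝ᵥ v)) := by
    intro v
    set b := B *ᵥ (T *ᵥ v) with hb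
    set w := (U.transpose * E) *ᵥ v with hw
    have e0 : A₀ *ᵥ (T *ᵥ v) = U *ᵥ b := by rw [hA, ← mulVec_mulVec]
    have e1 : (A₀ *ᵥ (T *ᵥ v)) ⬝ᵥ (E *ᵥ v) = b ⬝ᵥ w := by
      rw [e0, hw, ← mulVec_mulVec, dotProduct_mulVec b, vecMul_transpose]
    have e2 : (A₀ *ᵥ (T *ᵥ v)) ⬝ᵥ (A₀ *ᵥ (T *ᵥ v)) = b ⬝ᵥ b := by
      rw [e0, dotProduct_mulVec, ← mulVec_transpose, mulVec_mulVec, hU, one_mulVec]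
    have hww : w ⬝ᵥ w ≤ N * N * (ε * l) * (v ⬝ᵥ v) := by
      refine (mulVec_dotProduct_mulVec_le _ v).trans ?_
      refine mul_le_mul_of_nonneg_right ?_ (dotProduct_self_nonneg v)
      calc ∑ i, ∑ j, (U.transpose * E) i j ^ 2
          ≤ ∑ _i : Fin n, ∑ _j : Fin n ⊕ Fin d, ε * l :=
            Finset.sum_le_sum fun i _ => Finset.sum_le_sum fun j _ => hL i j
        _ = n * N * (ε * l) := by simp [hN]; ring
        _ ≤ N * N * (ε * l) := by gcongr
    -- Expanding `‖b ± 2w‖² ≥ 0` gives `|2 b·w| ≤ ‖b‖²/2 + 2‖w‖²`, so the cross term costs only half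
    -- of `‖A₀ T v‖²`.
    have hsq := dotProduct_self_nonneg (b + (2 : ℝ) • w)
    have hsq' := dotProduct_self_nonneg (b - (2 : ℝ) • w)
    simp only [add_dotProduct, dotProduct_add, sub_dotProduct, dotProduct_sub, smul_dotProduct,
      dotProduct_smul, smul_eq_mul, dotProduct_comm w b] at hsq hsq'
    rw [e1, e2, abs_le]
    constructor <;> linarith
  have hCv : ∀ v, (fromCols A₀ (A₀ * X₀) + E) *ᵥ v = A₀ *ᵥ (T *ᵥ v) + E *ᵥ v := by
    intro v
    rw [add_mulVec, mulVec_mulVec, hT, mul_fromCols, Matrix.mul_one]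
  have hCC : ∀ v, ((fromCols A₀ (A₀ * X₀) + E) *ᵥ v) ⬝ᵥ ((fromCols A₀ (A₀ * X₀) + E) *ᵥ v)
      = (A₀ *ᵥ (T *ᵥ v)) ⬝ᵥ (A₀ *ᵥ (T *ᵥ v)) + 2 * ((A₀ *ᵥ (T *ᵥ v)) ⬝ᵥ (E *ᵥ v))
        + (E *ᵥ v) ⬝ᵥ (E *ᵥ v) := by
    intro v
    rw [hCv, add_dotProduct, dotProduct_add, dotProduct_add, dotProduct_comm (E *ᵥ v)]
    ring
  have hκv : ∀ v : Fin n ⊕ Fin d → ℝ, 2 * (N * N * (ε * l) * (v ⬝ᵥ v)) + N * (ε * l) * (v ⬝ᵥ v)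
      ≤ κ * l * (v ⬝ᵥ v) := by
    intro v
    have := mul_le_mul_of_nonneg_right hεκ (dotProduct_self_nonneg v)
    linarith
  have hlow : ∀ v, 1 / 2 * (l * ((T *ᵥ v) ⬝ᵥ (T *ᵥ v))) + m * (v ⬝ᵥ S *ᵥ v) - κ * l * (v ⬝ᵥ v)
      ≤ ((fromCols A₀ (A₀ * X₀) + E) *ᵥ v) ⬝ᵥ ((fromCols A₀ (A₀ * X₀) + E) *ᵥ v) := by
    intro v
    have h1 := (abs_le.mp (herr v)).1
    have h2 := (abs_le.mp (hcross v)).1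
    have h3 := hκv v
    have h4 := lambdaMinGram_mul_le A₀ (T *ᵥ v)
    rw [hCC]
    linarith
  -- The level `m` compensates the mean of `‖E v‖²`; the margin `η λ` gives strict negativity
  -- without spoiling positivity.
  refine wellPosed_of_quadratic_forms hS X₀ _ (τ := m + η * l) (by positivity) ?_ ?_ ?_
  · intro v hv hv0
    have hT0 : T *ᵥ v = 0 := by
      rw [hTv]
      funext i
      exact hv0 i
    have h1 := (abs_le.mp (herr v)).2
    have h3 := hκv v
    have h4 := hcv v
    have h5 := dotProduct_self_pos hv
    have h6 : 0 ≤ 2 * (N * N * (ε * l) * (v ⬝ᵥ v)) := by positivity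
    rw [add_mulVec, dotProduct_add, hTT, hT0, dotProduct_zero, add_zero] at h4
    rw [hCC, hT0, mulVec_zero, zero_dotProduct, zero_dotProduct]
    have h7 : η * l * (c * (v ⬝ᵥ v)) ≤ η * l * (v ⬝ᵥ S *ᵥ v) :=
      mul_le_mul_of_nonneg_left h4 (by positivity)
    have h8 : κ * (l * (v ⬝ᵥ v)) ≤ η * c / 2 * (l * (v ⬝ᵥ v)) :=
      mul_le_mul_of_nonneg_right hκ1 (by positivity)
    have h9 : 0 < η * c * (l * (v ⬝ᵥ v)) := by positivity
    linarith
  · intro v hv hv0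
    have hT0 : T *ᵥ v = v ∘ Sum.inl := by
      rw [hTv]
      have : v ∘ Sum.inr = 0 := funext hv0
      rw [this, mulVec_zero, add_zero]
    have hTv' : (T *ᵥ v) ⬝ᵥ (T *ᵥ v) = v ⬝ᵥ v := by
      rw [hT0]
      simp [dotProduct, hv0]
    have h1 := hlow v
    have h5 := dotProduct_self_pos hv
    rw [hTv'] at h1
    have h7 : η * l * (v ⬝ᵥ S *ᵥ v) ≤ η * l * (K * (v ⬝ᵥ v)) :=
      mul_le_mul_of_nonneg_left (hKv v) (by positivity)
    have h8 : κ * (l * (v ⬝ᵥ v)) ≤ 1 / 8 * (l * (v ⬝ᵥ v)) :=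
      mul_le_mul_of_nonneg_right hκ2 (by positivity)
    have h9 : η * K * (l * (v ⬝ᵥ v)) ≤ 1 / 4 * (l * (v ⬝ᵥ v)) :=
      mul_le_mul_of_nonneg_right hηK (by positivity)
    have h10 : 0 < l * (v ⬝ᵥ v) := by positivity
    linarith
  · intro v hv hSv h0
    have h1 := hlow v
    have h4 := hcv v
    have h5 := dotProduct_self_pos hv
    rw [add_mulVec, dotProduct_add, hTT, hSv, dotProduct_zero, zero_add] at h4
    rw [h0, dotProduct_zero, hSv, dotProduct_zero] at h1
    have h7 : l * (c * (v ⬝ᵥ v)) ≤ l * ((T *ᵥ v) ⬝ᵥ (T *ᵥ v)) :=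
      mul_le_mul_of_nonneg_left h4 hl.le
    have h8 : κ * (l * (v ⬝ᵥ v)) ≤ c / 8 * (l * (v ⬝ᵥ v)) :=
      mul_le_mul_of_nonneg_right hκ3 (by positivity)
    have h9 : 0 < l * (c * (v ⬝ᵥ v)) := by positivity
    linarith

end Perturbation

end TLS

namespace TLS

/-! ### Moment bounds, a strong law and tail bounds for independent sums -/

section Sums

variable {Ω : Type*} [MeasurableSpace Ω] {P : Measure Ω} [IsProbabilityMeasure P]

theorem integral_abs_le_sqrt_integral_sq {V : Ω → ℝ} (hV : MemLp V 2 P) :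
    ∫ ω, |V ω| ∂P ≤ √(∫ ω, V ω ^ 2 ∂P) := by
  have h0 := variance_nonneg (fun ω => |V ω|) P
  have habs : MemLp (fun ω => |V ω|) 2 P := hV.abs
  rw [variance_eq_sub habs] at h0
  refine Real.le_sqrt_of_sq_le ?_
  have : ∫ ω, ((fun ω => |V ω|) ^ 2) ω ∂P = ∫ ω, V ω ^ 2 ∂P := by
    simp only [Pi.pow_apply, sq_abs]
  linarith

/-- A von Bahr–Esseen type bound, by truncation. -/
theorem integral_abs_sum_le {Y : ℕ → Ω → ℝ} (hind : iIndepFun Y P) (hmeas : ∀ i, Measurable (Y i))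
    (hint : ∀ i, Integrable (Y i) P) (hmean : ∀ i, ∫ ω, Y i ω ∂P = 0) {r : ℝ} (hr1 : 1 ≤ r)
    (hr2 : r ≤ 2) (hmom : ∀ i, Integrable (fun ω => |Y i ω| ^ r) P) {b : ℕ → ℝ}
    (hb : ∀ i, ∫ ω, |Y i ω| ^ r ∂P ≤ b i) (s : Finset ℕ) :
    ∫ ω, |∑ i ∈ s, Y i ω| ∂P ≤ √(∑ i ∈ s, b i) + 2 * ∑ i ∈ s, b i := by
  -- For `1 ≤ r ≤ 2`, truncation at `1` bounds both the second moment of the kept part and the first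
  -- moment of the rest by the `r`-th moment.
  set φ : ℝ → ℝ := fun x => if |x| ≤ 1 then x else 0 with hφ
  have hφm : Measurable φ :=
    Measurable.ite (measurableSet_le measurable_norm measurable_const) measurable_id
      measurable_const
  have hφ1 : ∀ x, |φ x| ≤ 1 := by
    intro x
    simp only [hφ]
    split_ifs with h
    · exact h
    · simp
  have hφsq : ∀ x, φ x ^ 2 ≤ |x| ^ r := by
    intro x
    simp only [hφ]
    split_ifs with h
    · rw [← sq_abs, ← Real.rpow_natCast]
      exact Real.rpow_le_rpow_of_exponent_ge_of_imp (abs_nonneg x) h (by simpa using hr2)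
        (by intro _ h2; norm_num at h2)
    · simpa using Real.rpow_nonneg (abs_nonneg x) r
  have hφsub : ∀ x, |x - φ x| ≤ |x| ^ r := by
    intro x
    simp only [hφ]
    split_ifs with h
    · simpa using Real.rpow_nonneg (abs_nonneg x) r
    · rw [sub_zero]
      push Not at h
      calc |x| = |x| ^ (1 : ℝ) := (Real.rpow_one _).symm
        _ ≤ |x| ^ r := Real.rpow_le_rpow_of_exponent_le h.le hr1
  set Z : ℕ → Ω → ℝ := fun i ω => φ (Y i ω) with hZ
  have hZm : ∀ i, Measurable (Z i) := fun i => hφm.comp (hmeas i)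
  have hZL : ∀ i, MemLp (Z i) 2 P := fun i =>
    MemLp.of_bound (hZm i).aestronglyMeasurable 1 (ae_of_all _ fun ω => hφ1 _)
  have hZint : ∀ i, Integrable (Z i) P := fun i => (hZL i).integrable one_le_two
  have hres : ∀ i, ∫ ω, |Y i ω - Z i ω| ∂P ≤ b i := fun i =>
    (integral_mono ((hint i).sub (hZint i)).abs (hmom i) fun ω => hφsub _).trans (hb i)
  -- Since `Y i` has mean zero, truncation shifts the mean by no more than the discarded part; this
  -- accounts for the second `∑ b i` in the bound.
  have hmeanZ : ∀ i, |∫ ω, Z i ω ∂P| ≤ b i := by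
    intro i
    have e : ∫ ω, (Y i ω - Z i ω) ∂P = -∫ ω, Z i ω ∂P := by
      rw [integral_sub (hint i) (hZint i), hmean, zero_sub]
    rw [← abs_neg, ← e]
    exact abs_integral_le_integral_abs.trans (hres i)
  have hvar : ∀ i, Var[Z i; P] ≤ b i := by
    intro i
    rw [variance_eq_sub (hZL i)]
    have : ∫ ω, (Z i ^ 2) ω ∂P ≤ ∫ ω, |Y i ω| ^ r ∂P :=
      integral_mono (hZL i).integrable_sq (hmom i) fun ω => hφsq _
    nlinarith [hb i, sq_nonneg (∫ ω, Z i ω ∂P)]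
  have hsumL : MemLp (∑ i ∈ s, Z i) 2 P := memLp_finsetSum' s fun i _ => hZL i
  have hvarsum : Var[∑ i ∈ s, Z i; P] ≤ ∑ i ∈ s, b i := by
    rw [IndepFun.variance_sum (fun i _ => hZL i)]
    · exact Finset.sum_le_sum fun i _ => hvar i
    · intro i _ j _ hij
      exact (hind.indepFun hij).comp hφm hφm
  have hcent : MemLp (fun ω => (∑ i ∈ s, Z i) ω - ∫ x, (∑ i ∈ s, Z i) x ∂P) 2 P :=
    hsumL.sub (memLp_const _)
  have hmain : ∫ ω, |(∑ i ∈ s, Z i) ω - ∫ x, (∑ i ∈ s, Z i) x ∂P| ∂P ≤ √(∑ i ∈ s, b i) := by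
    refine (integral_abs_le_sqrt_integral_sq hcent).trans (Real.sqrt_le_sqrt ?_)
    rwa [variance_eq_integral hsumL.aemeasurable] at hvarsum
  have hEsum : ∫ x, (∑ i ∈ s, Z i) x ∂P = ∑ i ∈ s, ∫ x, Z i x ∂P := by
    simp only [Finset.sum_apply]
    exact integral_finsetSum s fun i _ => hZint i
  have hpt : ∀ ω, |∑ i ∈ s, Y i ω| ≤ |(∑ i ∈ s, Z i) ω - ∫ x, (∑ i ∈ s, Z i) x ∂P|
      + (∑ i ∈ s, |Y i ω - Z i ω| + ∑ i ∈ s, b i) := by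
    intro ω
    have e : ∑ i ∈ s, Y i ω = ((∑ i ∈ s, Z i) ω - ∫ x, (∑ i ∈ s, Z i) x ∂P)
        + (∑ i ∈ s, (Y i ω - Z i ω) + ∑ i ∈ s, ∫ x, Z i x ∂P) := by
      rw [hEsum, Finset.sum_apply, Finset.sum_sub_distrib]
      ring
    rw [e]
    refine (abs_add_le _ _).trans (add_le_add_right ((abs_add_le _ _).trans ?_) _)
    refine add_le_add (Finset.abs_sum_le_sum_abs _ _) ((Finset.abs_sum_le_sum_abs _ _).trans ?_)
    exact Finset.sum_le_sum fun i _ => hmeanZ i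
  have hi1 : Integrable (fun ω => |(∑ i ∈ s, Z i) ω - ∫ x, (∑ i ∈ s, Z i) x ∂P|) P :=
    (hcent.integrable one_le_two).abs
  have hi2 : ∀ i, Integrable (fun ω => |Y i ω - Z i ω|) P := fun i =>
    ((hint i).sub (hZint i)).abs
  have hi3 : Integrable (fun ω => ∑ i ∈ s, |Y i ω - Z i ω| + ∑ i ∈ s, b i) P :=
    (integrable_finsetSum s fun i _ => hi2 i).add (integrable_const _)
  calc ∫ ω, |∑ i ∈ s, Y i ω| ∂P
      ≤ ∫ ω, (|(∑ i ∈ s, Z i) ω - ∫ x, (∑ i ∈ s, Z i) x ∂P|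
          + (∑ i ∈ s, |Y i ω - Z i ω| + ∑ i ∈ s, b i)) ∂P :=
        integral_mono (integrable_finsetSum s fun i _ => hint i).abs (hi1.add hi3) hpt
    _ = ∫ ω, |(∑ i ∈ s, Z i) ω - ∫ x, (∑ i ∈ s, Z i) x ∂P| ∂P
          + (∑ i ∈ s, ∫ ω, |Y i ω - Z i ω| ∂P + ∑ i ∈ s, b i) := by
        rw [integral_add hi1 hi3, integral_add (integrable_finsetSum s fun i _ => hi2 i)
          (integrable_const _), integral_finsetSum s fun i _ => hi2 i]
        simp
    _ ≤ √(∑ i ∈ s, b i) + (∑ i ∈ s, b i + ∑ i ∈ s, b i) := by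
        gcongr with i _
        exact hres i
    _ = _ := by ring

/-- The partial sums form a martingale bounded in `L¹`, so Doob's convergence theorem applies. -/
theorem ae_exists_tendsto_sum {Y : ℕ → Ω → ℝ} (hind : iIndepFun Y P)
    (hmeas : ∀ i, Measurable (Y i)) (hint : ∀ i, Integrable (Y i) P)
    (hmean : ∀ i, ∫ ω, Y i ω ∂P = 0) {R : ℝ}
    (hR : ∀ n, ∫ ω, |∑ i ∈ Finset.range n, Y i ω| ∂P ≤ R) :
    ∀ᵐ ω ∂P, ∃ s, Tendsto (fun n => ∑ i ∈ Finset.range n, Y i ω) atTop (𝓝 s) := by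
  have hsm : ∀ i, StronglyMeasurable (Y i) := fun i => (hmeas i).stronglyMeasurable
  -- The sum runs up to and including index `n`, matching the natural filtration at time `n`.
  set f : ℕ → Ω → ℝ := fun n => ∑ i ∈ Finset.range (n + 1), Y i with hf
  have hfint : ∀ n, Integrable (f n) P := fun n => integrable_finsetSum' _ fun i _ => hint i
  have hmart : Martingale f (Filtration.natural Y hsm) P := by
    refine martingale_of_condExp_sub_eq_zero_nat (fun n => ?_) hfint fun n => ?_
    · refine Finset.stronglyMeasurable_sum _ fun i hi => ?_
      exact (Filtration.stronglyAdapted_natural hsm i).mono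
        ((Filtration.natural Y hsm).mono (Nat.lt_succ_iff.mp (Finset.mem_range.mp hi)))
    · have e : f (n + 1) - f n = Y (n + 1) := by
        simp only [hf]
        rw [Finset.sum_range_succ _ (n + 1), add_sub_cancel_left]
      rw [e]
      refine (iIndepFun.condExp_natural_ae_eq_of_lt hsm hind (Nat.lt_succ_self n)).trans ?_
      rw [hmean]
      rfl
  have hbdd : ∀ n, eLpNorm (f n) 1 P ≤ (R.toNNReal : ENNReal) := by
    intro n
    rw [eLpNorm_one_eq_lintegral_enorm, ← ofReal_integral_norm_eq_lintegral_enorm (hfint n)]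
    refine ENNReal.ofReal_le_ofReal ?_
    refine le_trans (le_of_eq ?_) (hR (n + 1))
    simp only [hf, Finset.sum_apply, Real.norm_eq_abs]
  filter_upwards [hmart.submartingale.exists_ae_tendsto_of_bdd hbdd] with ω ⟨s, hs⟩
  refine ⟨s, (tendsto_add_atTop_iff_nat 1).mp ?_⟩
  simpa [hf] using hs

/-- Kronecker's lemma. -/
theorem tendsto_sum_mul_div_of_tendsto_sum {b y : ℕ → ℝ} (hb : Monotone b)
    (hbtop : Tendsto b atTop atTop) {s : ℝ}
    (hs : Tendsto (fun n => ∑ i ∈ Finset.range n, y i) atTop (𝓝 s)) :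
    Tendsto (fun n => (∑ i ∈ Finset.range n, b i * y i) / b n) atTop (𝓝 0) := by
  set t : ℕ → ℝ := fun n => ∑ i ∈ Finset.range n, y i - s with ht
  have ht0 : Tendsto t atTop (𝓝 0) := by
    have := hs.sub_const s
    rwa [sub_self] at this
  have htele : ∀ n, ∑ i ∈ Finset.range n, (b (i + 1) - b i) = b n - b 0 :=
    fun n => Finset.sum_range_sub b n
  -- Summation by parts in terms of the tails `t`; the boundary term `s * b 0` comes from `t 0 =
  -- -s`.
  have hid : ∀ n, ∑ i ∈ Finset.range n, b i * y i
      = b n * t n + s * b 0 - ∑ i ∈ Finset.range n, (b (i + 1) - b i) * t (i + 1) := by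
    intro n
    induction n with
    | zero => simp [ht]; ring
    | succ n ih =>
      rw [Finset.sum_range_succ, ih, Finset.sum_range_succ _ n]
      have : t (n + 1) = t n + y n := by
        simp only [ht, Finset.sum_range_succ]; ring
      rw [this]
      ring
  have hlo : (fun n => ∑ i ∈ Finset.range n, (b (i + 1) - b i) * t (i + 1))
      =o[atTop] fun n => ∑ i ∈ Finset.range n, (b (i + 1) - b i) := by
    refine Asymptotics.IsLittleO.sum_range ?_ (fun i => sub_nonneg.mpr (hb (Nat.le_succ i))) ?_
    · have h1 : (fun i => t (i + 1)) =o[atTop] fun _ => (1 : ℝ) :=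
        (Asymptotics.isLittleO_one_iff ℝ).mpr ((tendsto_add_atTop_iff_nat 1).mpr ht0)
      have := (Asymptotics.isBigO_refl (fun i => b (i + 1) - b i) atTop).mul_isLittleO h1
      simpa using this
    · simp only [htele]
      exact tendsto_atTop_add_const_right _ _ hbtop
  have hO : (fun n => ∑ i ∈ Finset.range n, (b (i + 1) - b i)) =O[atTop] b := by
    simp only [htele]
    refine (Asymptotics.isBigO_refl b atTop).sub (Asymptotics.IsLittleO.isBigO ?_)
    exact Asymptotics.isLittleO_const_left.mpr (Or.inr (tendsto_norm_atTop_atTop.comp hbtop))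
  have h3 := (hlo.trans_isBigO hO).tendsto_div_nhds_zero
  have h4 : Tendsto (fun n => s * b 0 / b n) atTop (𝓝 0) := tendsto_const_nhds.div_atTop hbtop
  have h5 := (ht0.add h4).sub h3
  simp only [add_zero, sub_zero] at h5
  refine h5.congr' ?_
  filter_upwards [hbtop.eventually_gt_atTop 0] with n hn
  rw [hid, sub_div, add_div, mul_div_cancel_left₀ _ hn.ne']

theorem tendsto_atTop_of_summable_one_div_rpow {b : ℕ → ℝ} (hb0 : ∀ i, 0 < b i) {r : ℝ}
    (hr : 1 ≤ r) (hsum : Summable fun i => 1 / b i ^ r) : Tendsto b atTop atTop := by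
  have h1 : Tendsto (fun i => (1 / b i ^ r)⁻¹) atTop atTop := by
    refine Tendsto.inv_tendsto_nhdsGT_zero ?_
    exact tendsto_nhdsWithin_iff.mpr ⟨hsum.tendsto_atTop_zero,
      Eventually.of_forall fun i => one_div_pos.mpr (Real.rpow_pos_of_pos (hb0 i) r)⟩
  have h2 := (tendsto_rpow_atTop (y := 1 / r) (by positivity)).comp h1
  refine h2.congr fun i => ?_
  simp only [Function.comp_apply, one_div, inv_inv]
  exact Real.rpow_rpow_inv (hb0 i).le (by positivity)

/-- The series `∑ X i / b i` has partial sums bounded in `L¹` by the truncation bound, hence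
converges almost surely, and Kronecker's lemma turns this into the strong law. -/
theorem ae_tendsto_sum_div {X : ℕ → Ω → ℝ} (hind : iIndepFun X P) (hmeas : ∀ i, Measurable (X i))
    (hint : ∀ i, Integrable (X i) P) (hmean : ∀ i, ∫ ω, X i ω ∂P = 0) {r K : ℝ} (hr1 : 1 ≤ r)
    (hr2 : r ≤ 2) (hmom : ∀ i, Integrable (fun ω => |X i ω| ^ r) P)
    (hK : ∀ i, ∫ ω, |X i ω| ^ r ∂P ≤ K) {b : ℕ → ℝ} (hb : Monotone b) (hb0 : ∀ i, 0 < b i)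
    (hsum : Summable fun i => 1 / b i ^ r) :
    ∀ᵐ ω ∂P, Tendsto (fun m => (∑ i ∈ Finset.range m, X i ω) / b m) atTop (𝓝 0) := by
  have hK0 : 0 ≤ K := (integral_nonneg fun ω => Real.rpow_nonneg (abs_nonneg _) r).trans (hK 0)
  have hpow : ∀ i ω, |X i ω / b i| ^ r = |X i ω| ^ r * (1 / b i ^ r) := by
    intro i ω
    rw [abs_div, abs_of_pos (hb0 i), Real.div_rpow (abs_nonneg _) (hb0 i).le, ← mul_one_div]
  have hbd := integral_abs_sum_le (Y := fun i ω => X i ω / b i)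
    (hind.comp (fun i x => x / b i) fun i => measurable_id.div_const _)
    (fun i => (hmeas i).div_const _) (fun i => (hint i).div_const _)
    (fun i => by rw [integral_div, hmean, zero_div]) hr1 hr2
    (fun i => by simp only [hpow]; exact (hmom i).mul_const _)
    (b := fun i => K * (1 / b i ^ r))
    (fun i => by
      simp only [hpow]
      rw [integral_mul_const]
      exact mul_le_mul_of_nonneg_right (hK i) (one_div_nonneg.mpr (Real.rpow_nonneg (hb0 i).le r)))
  have hpos : ∀ i, 0 ≤ K * (1 / b i ^ r) := fun i =>
    mul_nonneg hK0 (one_div_nonneg.mpr (Real.rpow_nonneg (hb0 i).le r))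
  have hle : ∀ n, ∑ i ∈ Finset.range n, K * (1 / b i ^ r) ≤ ∑' i, K * (1 / b i ^ r) := fun n =>
    (hsum.mul_left K).sum_le_tsum _ fun i _ => hpos i
  have hconv := ae_exists_tendsto_sum (Y := fun i ω => X i ω / b i)
    (hind.comp (fun i x => x / b i) fun i => measurable_id.div_const _)
    (fun i => (hmeas i).div_const _) (fun i => (hint i).div_const _)
    (fun i => by rw [integral_div, hmean, zero_div])
    (R := √(∑' i, K * (1 / b i ^ r)) + 2 * ∑' i, K * (1 / b i ^ r))
    (fun n => (hbd (Finset.range n)).trans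
      (add_le_add (Real.sqrt_le_sqrt (hle n)) (by linarith [hle n])))
  filter_upwards [hconv] with ω ⟨s, hs⟩
  have h := tendsto_sum_mul_div_of_tendsto_sum hb
    (tendsto_atTop_of_summable_one_div_rpow hb0 hr1 hsum) hs
  refine h.congr fun n => ?_
  congr 1
  exact Finset.sum_congr rfl fun i _ => mul_div_cancel₀ _ (hb0 i).ne'

/-- Squares of `A + B Z` for `Z` centred and independent of the pair `(A, B)`. -/
theorem memLp_add_mul_of_indepFun {A B Z : Ω → ℝ} (hind : IndepFun (fun ω => (A ω, B ω)) Z P)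
    (hA : MemLp A 2 P) (hB : MemLp B 2 P) (hZ : MemLp Z 2 P) (hmean : ∫ ω, Z ω ∂P = 0) :
    MemLp (fun ω => A ω + B ω * Z ω) 2 P ∧
      ∫ ω, (A ω + B ω * Z ω) ^ 2 ∂P
        = ∫ ω, A ω ^ 2 ∂P + (∫ ω, B ω ^ 2 ∂P) * ∫ ω, Z ω ^ 2 ∂P := by
  have hAB : Integrable (fun ω => A ω * B ω) P := hA.integrable_mul hB
  have hind1 : IndepFun (fun ω => A ω * B ω) Z P :=
    hind.comp (measurable_fst.mul measurable_snd) measurable_id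
  have hind2 : IndepFun (fun ω => B ω ^ 2) (fun ω => Z ω ^ 2) P :=
    hind.comp (φ := fun x : ℝ × ℝ => x.2 ^ 2) (ψ := fun x : ℝ => x ^ 2)
      (measurable_snd.pow_const 2) (measurable_id.pow_const 2)
  have h2 : Integrable (fun ω => B ω ^ 2 * Z ω ^ 2) P :=
    hind2.integrable_mul hB.integrable_sq hZ.integrable_sq
  have h1 : Integrable (fun ω => A ω * B ω * Z ω) P :=
    hind1.integrable_mul hAB (hZ.integrable one_le_two)
  have hBZ : MemLp (fun ω => B ω * Z ω) 2 P := by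
    refine (memLp_two_iff_integrable_sq (hB.1.mul hZ.1)).mpr ?_
    simpa only [Pi.mul_apply, mul_pow] using h2
  refine ⟨hA.add hBZ, ?_⟩
  have e : ∀ ω, (A ω + B ω * Z ω) ^ 2 = A ω ^ 2 + (2 * (A ω * B ω * Z ω) + B ω ^ 2 * Z ω ^ 2) :=
    fun ω => by ring
  simp only [e]
  have h3 : Integrable (fun ω => 2 * (A ω * B ω * Z ω) + B ω ^ 2 * Z ω ^ 2) P :=
    (h1.const_mul 2).add h2
  rw [integral_add hA.integrable_sq h3, integral_add (h1.const_mul 2) h2,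
    integral_const_mul, hind1.integral_fun_mul_eq_mul_integral hAB.1 hZ.1, hmean,
    hind2.integral_fun_mul_eq_mul_integral hB.integrable_sq.1 hZ.integrable_sq.1]
  ring

/-- Let `L k` be the linear form and `O k` the off-diagonal part of its square. Then `O (k+1) = O k
+ 2 u k L k ξ k` with `ξ k` centred and independent of the past, so second moments simply add. Only
second moments of `ξ` are needed, though `O` is quadratic. -/
theorem integral_linear_and_offDiagonal_sq_le {ξ : ℕ → Ω → ℝ} (hind : iIndepFun ξ P)
    (hmeas : ∀ i, Measurable (ξ i)) (hL2 : ∀ i, MemLp (ξ i) 2 P)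
    (hmean : ∀ i, ∫ ω, ξ i ω ∂P = 0) {s : ℝ} (hs : ∀ i, ∫ ω, ξ i ω ^ 2 ∂P ≤ s) (u : ℕ → ℝ)
    (k : ℕ) :
    (MemLp (fun ω => ∑ i ∈ Finset.range k, u i * ξ i ω) 2 P ∧
      ∫ ω, (∑ i ∈ Finset.range k, u i * ξ i ω) ^ 2 ∂P ≤ s * ∑ i ∈ Finset.range k, u i ^ 2) ∧
    MemLp (fun ω => (∑ i ∈ Finset.range k, u i * ξ i ω) ^ 2
        - ∑ i ∈ Finset.range k, u i ^ 2 * ξ i ω ^ 2) 2 P ∧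
      ∫ ω, ((∑ i ∈ Finset.range k, u i * ξ i ω) ^ 2
        - ∑ i ∈ Finset.range k, u i ^ 2 * ξ i ω ^ 2) ^ 2 ∂P
        ≤ 2 * s ^ 2 * (∑ i ∈ Finset.range k, u i ^ 2) ^ 2 := by
  have hs0 : 0 ≤ s := (integral_nonneg fun ω => sq_nonneg _).trans (hs 0)
  induction k with
  | zero => simp
  | succ k ih =>
    obtain ⟨⟨hL, hLs⟩, hO, hOs⟩ := ih
    have htup := hind.indepFun_finset (Finset.range k) {k} (by simp) hmeas
    have hk : k ∈ ({k} : Finset ℕ) := Finset.mem_singleton_self k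
    -- Independence of `ξ k` from any measurable function of the earlier variables, applied to the
    -- pairs `(L k, u k)` and `(O k, 2 u k L k)`.
    have hindp : ∀ {g : (Finset.range k → ℝ) → ℝ × ℝ}, Measurable g →
        IndepFun (fun ω => g fun i => ξ i ω) (ξ k) P := fun hg =>
      htup.comp (ψ := fun x : ({k} : Finset ℕ) → ℝ => x ⟨k, hk⟩) hg (measurable_pi_apply _)
    have hgL : Measurable fun x : Finset.range k → ℝ => ∑ i : Finset.range k, u i * x i :=
      Finset.measurable_sum _ fun i _ => (measurable_pi_apply i).const_mul _
    have hgD : Measurable fun x : Finset.range k → ℝ => ∑ i : Finset.range k, u i ^ 2 * x i ^ 2 :=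
      Finset.measurable_sum _ fun i _ => ((measurable_pi_apply i).pow_const 2).const_mul _
    have eL : ∀ ω, ∑ i : Finset.range k, u i * ξ i ω = ∑ i ∈ Finset.range k, u i * ξ i ω :=
      fun ω => Finset.sum_coe_sort (Finset.range k) fun i => u i * ξ i ω
    have eD : ∀ ω, ∑ i : Finset.range k, u i ^ 2 * ξ i ω ^ 2
        = ∑ i ∈ Finset.range k, u i ^ 2 * ξ i ω ^ 2 :=
      fun ω => Finset.sum_coe_sort (Finset.range k) fun i => u i ^ 2 * ξ i ω ^ 2
    have hi1 := hindp (hgL.prodMk (measurable_const (a := u k)))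
    have hi2 := hindp (((hgL.pow_const 2).sub hgD).prodMk (hgL.const_mul (2 * u k)))
    simp only [Pi.sub_apply, eL, eD] at hi1 hi2
    obtain ⟨a1, a2⟩ := memLp_add_mul_of_indepFun hi1 hL (memLp_const _) (hL2 k) (hmean k)
    obtain ⟨b1, b2⟩ := memLp_add_mul_of_indepFun hi2 hO (hL.const_mul _) (hL2 k) (hmean k)
    have e1 : ∀ ω, ∑ i ∈ Finset.range (k + 1), u i * ξ i ω
        = ∑ i ∈ Finset.range k, u i * ξ i ω + u k * ξ k ω := fun ω => Finset.sum_range_succ _ _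
    have e2 : ∀ ω, (∑ i ∈ Finset.range (k + 1), u i * ξ i ω) ^ 2
          - ∑ i ∈ Finset.range (k + 1), u i ^ 2 * ξ i ω ^ 2
        = (∑ i ∈ Finset.range k, u i * ξ i ω) ^ 2 - ∑ i ∈ Finset.range k, u i ^ 2 * ξ i ω ^ 2
          + 2 * u k * (∑ i ∈ Finset.range k, u i * ξ i ω) * ξ k ω := by
      intro ω
      rw [e1, Finset.sum_range_succ]
      ring
    have hu0 : 0 ≤ ∑ i ∈ Finset.range k, u i ^ 2 := Finset.sum_nonneg fun i _ => sq_nonneg _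
    have hξ0 : 0 ≤ ∫ ω, ξ k ω ^ 2 ∂P := integral_nonneg fun ω => sq_nonneg _
    refine ⟨⟨?_, ?_⟩, ?_, ?_⟩
    · simpa only [e1] using a1
    · simp only [e1]
      rw [a2, Finset.sum_range_succ, mul_add]
      refine add_le_add hLs ?_
      simp only [integral_const, probReal_univ, smul_eq_mul, one_mul]
      rw [mul_comm]
      exact mul_le_mul_of_nonneg_right (hs k) (sq_nonneg _)
    · simpa only [e2] using b1
    · simp only [e2]
      rw [b2, Finset.sum_range_succ]
      simp only [mul_pow, integral_const_mul]
      have h1 : (∫ ω, (∑ i ∈ Finset.range k, u i * ξ i ω) ^ 2 ∂P) * ∫ ω, ξ k ω ^ 2 ∂P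
          ≤ (s * ∑ i ∈ Finset.range k, u i ^ 2) * s :=
        mul_le_mul hLs (hs k) hξ0 (by positivity)
      have h2 := mul_le_mul_of_nonneg_left h1 (show 0 ≤ 4 * u k ^ 2 by positivity)
      -- This is the surplus in `2 s² (V + u²)²` over `2 s² V² + 4 s² u² V`, where `V` is the sum of
      -- the earlier `u i ^ 2` and `u = u k`.
      have h3 : 0 ≤ 2 * s ^ 2 * (u k ^ 2) ^ 2 := by positivity
      nlinarith

theorem measureReal_linear_sq_ge_le {ξ : ℕ → Ω → ℝ} (hind : iIndepFun ξ P)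
    (hmeas : ∀ i, Measurable (ξ i)) (hL2 : ∀ i, MemLp (ξ i) 2 P)
    (hmean : ∀ i, ∫ ω, ξ i ω ∂P = 0) {s : ℝ} (hs : ∀ i, ∫ ω, ξ i ω ^ 2 ∂P ≤ s) {u : ℕ → ℝ} {k : ℕ}
    (hu : ∑ i ∈ Finset.range k, u i ^ 2 = 1) {a : ℝ} (ha : 0 < a) :
    P.real {ω | a ≤ (∑ i ∈ Finset.range k, u i * ξ i ω) ^ 2} ≤ s / a := by
  obtain ⟨⟨hL, hLs⟩, -⟩ := integral_linear_and_offDiagonal_sq_le hind hmeas hL2 hmean hs u k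
  have := mul_meas_ge_le_integral_of_nonneg (ae_of_all _ fun ω => sq_nonneg _) hL.integrable_sq a
  rw [hu, mul_one] at hLs
  rw [le_div_iff₀ ha, mul_comm]
  exact this.trans hLs

/-- Chebyshev yields only `1/a`, too weak for Borel–Cantelli in general. Split the square into
diagonal and off-diagonal parts: the diagonal is a convex combination of the `ξ i ^ 2`, so Jensen
controls its `r`-th moment, and the off-diagonal part has a bounded second moment. -/
theorem measureReal_linear_sq_ge_le_rpow {ξ : ℕ → Ω → ℝ} (hind : iIndepFun ξ P)
    (hmeas : ∀ i, Measurable (ξ i)) (hL2 : ∀ i, MemLp (ξ i) 2 P)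
    (hmean : ∀ i, ∫ ω, ξ i ω ∂P = 0) {s : ℝ} (hs : ∀ i, ∫ ω, ξ i ω ^ 2 ∂P ≤ s) {r K : ℝ}
    (hr : 1 ≤ r) (hmom : ∀ i, Integrable (fun ω => |ξ i ω| ^ (2 * r)) P)
    (hK : ∀ i, ∫ ω, |ξ i ω| ^ (2 * r) ∂P ≤ K) {u : ℕ → ℝ} {k : ℕ}
    (hu : ∑ i ∈ Finset.range k, u i ^ 2 = 1) {a : ℝ} (ha : 0 < a) :
    P.real {ω | a ≤ (∑ i ∈ Finset.range k, u i * ξ i ω) ^ 2}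
      ≤ K / (a / 2) ^ r + 2 * s ^ 2 / (a / 2) ^ 2 := by
  obtain ⟨-, hO, hOs⟩ := integral_linear_and_offDiagonal_sq_le hind hmeas hL2 hmean hs u k
  rw [hu, one_pow, mul_one] at hOs
  have hpow : ∀ x : ℝ, (x ^ 2) ^ r = |x| ^ (2 * r) := by
    intro x
    rw [← sq_abs, ← Real.rpow_natCast, ← Real.rpow_mul (abs_nonneg x)]
    norm_num
  have hjensen : ∀ ω, (∑ i ∈ Finset.range k, u i ^ 2 * ξ i ω ^ 2) ^ r
      ≤ ∑ i ∈ Finset.range k, u i ^ 2 * |ξ i ω| ^ (2 * r) := by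
    intro ω
    have := Real.rpow_arith_mean_le_arith_mean_rpow (Finset.range k) (fun i => u i ^ 2)
      (fun i => ξ i ω ^ 2) (fun i _ => sq_nonneg _) hu (fun i _ => sq_nonneg _) hr
    simpa only [hpow] using this
  have hDint : Integrable (fun ω => ∑ i ∈ Finset.range k, u i ^ 2 * |ξ i ω| ^ (2 * r)) P :=
    integrable_finsetSum _ fun i _ => (hmom i).const_mul _
  have hDle : ∫ ω, ∑ i ∈ Finset.range k, u i ^ 2 * |ξ i ω| ^ (2 * r) ∂P ≤ K := by
    rw [integral_finsetSum _ fun i _ => (hmom i).const_mul _]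
    simp only [integral_const_mul]
    calc ∑ i ∈ Finset.range k, u i ^ 2 * ∫ ω, |ξ i ω| ^ (2 * r) ∂P
        ≤ ∑ i ∈ Finset.range k, u i ^ 2 * K :=
          Finset.sum_le_sum fun i _ => mul_le_mul_of_nonneg_left (hK i) (sq_nonneg _)
      _ = K := by rw [← Finset.sum_mul, hu, one_mul]
  -- If the square reaches `a`, either the diagonal part or the off-diagonal part reaches `a / 2`.
  have hsub : {ω | a ≤ (∑ i ∈ Finset.range k, u i * ξ i ω) ^ 2}
      ⊆ {ω | (a / 2) ^ r ≤ ∑ i ∈ Finset.range k, u i ^ 2 * |ξ i ω| ^ (2 * r)}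
        ∪ {ω | (a / 2) ^ 2 ≤ ((∑ i ∈ Finset.range k, u i * ξ i ω) ^ 2
            - ∑ i ∈ Finset.range k, u i ^ 2 * ξ i ω ^ 2) ^ 2} := by
    intro ω hω
    simp only [Set.mem_ofPred_eq, Set.mem_union] at hω ⊢
    rcases le_total (a / 2) (∑ i ∈ Finset.range k, u i ^ 2 * ξ i ω ^ 2) with h | h
    · left
      exact (Real.rpow_le_rpow (by positivity) h (by linarith)).trans (hjensen ω)
    · right
      exact pow_le_pow_left₀ (by positivity) (by linarith) 2
  refine (measureReal_mono hsub).trans ((measureReal_union_le _ _).trans (add_le_add ?_ ?_))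
  · rw [le_div_iff₀ (by positivity), mul_comm]
    refine (mul_meas_ge_le_integral_of_nonneg (ae_of_all _ fun ω => ?_) hDint _).trans hDle
    exact Finset.sum_nonneg fun i _ =>
      mul_nonneg (sq_nonneg _) (Real.rpow_nonneg (abs_nonneg _) _)
  · rw [le_div_iff₀ (by positivity), mul_comm]
    exact (mul_meas_ge_le_integral_of_nonneg (ae_of_all _ fun ω => sq_nonneg _)
      hO.integrable_sq _).trans hOs

end Sums

end TLS

namespace TLS

/-! ### Consequences of the moment assumption -/

section Moments

variable {Ω : Type*} [MeasurableSpace Ω] {P : Measure Ω} {n d : ℕ}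
  {c : ℕ → Ω → (Fin n ⊕ Fin d) → ℝ}

theorem BoundedMoments.exists_bound {r : ℝ} (hr : 1 ≤ r) (hc : ∀ i, Measurable (c i))
    (h : BoundedMoments P c r) : ∃ K : ℝ, ∀ i j,
      Integrable (fun ω => |c i ω j| ^ (2 * r)) P ∧ ∫ ω, |c i ω j| ^ (2 * r) ∂P ≤ K := by
  refine ⟨(⨆ i, ⨆ j, ∫⁻ ω, ‖c i ω j‖ₑ ^ (2 * r) ∂P).toReal, fun i j => ?_⟩
  have hm : Measurable fun ω => |c i ω j| ^ (2 * r) :=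
    ((measurable_pi_iff.mp (hc i) j).abs).pow_const _
  have hle : ∫⁻ ω, ‖c i ω j‖ₑ ^ (2 * r) ∂P ≤ ⨆ i, ⨆ j, ∫⁻ ω, ‖c i ω j‖ₑ ^ (2 * r) ∂P :=
    le_iSup₂ (f := fun i j => ∫⁻ ω, ‖c i ω j‖ₑ ^ (2 * r) ∂P) i j
  have he : ∀ ω, ENNReal.ofReal (|c i ω j| ^ (2 * r)) = ‖c i ω j‖ₑ ^ (2 * r) := by
    intro ω
    rw [← ENNReal.ofReal_rpow_of_nonneg (abs_nonneg _) (by positivity), Real.enorm_eq_ofReal_abs]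
  have h0 : ∀ ω, 0 ≤ |c i ω j| ^ (2 * r) := fun ω => Real.rpow_nonneg (abs_nonneg _) _
  have hint : Integrable (fun ω => |c i ω j| ^ (2 * r)) P := by
    refine ⟨hm.aestronglyMeasurable, ?_⟩
    rw [hasFiniteIntegral_iff_ofReal (ae_of_all _ h0)]
    simp only [he]
    exact hle.trans_lt h
  refine ⟨hint, ?_⟩
  rw [integral_eq_lintegral_of_nonneg_ae (ae_of_all _ h0) hm.aestronglyMeasurable]
  simp only [he]
  exact ENNReal.toReal_mono h.ne hle

theorem BoundedMoments.mono [IsProbabilityMeasure P] {r r' : ℝ} (hr : 0 ≤ r') (hrr : r' ≤ r)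
    (h : BoundedMoments P c r) : BoundedMoments P c r' := by
  have hle : ∀ x : ENNReal, x ^ (2 * r') ≤ 1 + x ^ (2 * r) := by
    intro x
    rcases le_total x 1 with hx | hx
    · exact (ENNReal.rpow_le_one hx (by positivity)).trans le_self_add
    · exact (ENNReal.rpow_le_rpow_of_exponent_le hx (by linarith)).trans le_add_self
  refine lt_of_le_of_lt ?_ (ENNReal.add_lt_top.mpr ⟨ENNReal.one_lt_top, h⟩)
  refine iSup₂_le fun i j => ?_
  calc ∫⁻ ω, ‖c i ω j‖ₑ ^ (2 * r') ∂P ≤ ∫⁻ ω, (1 + ‖c i ω j‖ₑ ^ (2 * r)) ∂P :=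
        lintegral_mono fun ω => hle _
    _ = 1 + ∫⁻ ω, ‖c i ω j‖ₑ ^ (2 * r) ∂P := by
        rw [lintegral_add_left measurable_const]
        simp
    _ ≤ _ := by
        gcongr
        exact le_iSup₂ (f := fun i j => ∫⁻ ω, ‖c i ω j‖ₑ ^ (2 * r) ∂P) i j

theorem abs_mul_sub_rpow_le {r : ℝ} (hr : 1 ≤ r) (x y s : ℝ) :
    |x * y - s| ^ r ≤ 2 ^ r * (|x| ^ (2 * r) + |y| ^ (2 * r) + |s| ^ r) := by
  have hr0 : 0 ≤ r := by linarith
  have hx := Real.rpow_nonneg (abs_nonneg x) (2 * r)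
  have hy := Real.rpow_nonneg (abs_nonneg y) (2 * r)
  have hs := Real.rpow_nonneg (abs_nonneg s) r
  have hsq : ∀ z : ℝ, (z ^ 2) ^ r = |z| ^ (2 * r) := by
    intro z
    rw [← sq_abs, ← Real.rpow_natCast, ← Real.rpow_mul (abs_nonneg z)]
    norm_num
  have hmax : |x * y| ^ r ≤ |x| ^ (2 * r) + |y| ^ (2 * r) := by
    rw [abs_mul]
    rcases le_total |x| |y| with h | h
    · have : |x| * |y| ≤ y ^ 2 := by rw [← sq_abs y, sq]; gcongr
      have := Real.rpow_le_rpow (by positivity) this hr0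
      rw [hsq] at this
      linarith
    · have : |x| * |y| ≤ x ^ 2 := by rw [← sq_abs x, sq]; gcongr
      have := Real.rpow_le_rpow (by positivity) this hr0
      rw [hsq] at this
      linarith
  have h2 : (0 : ℝ) ≤ 2 ^ r := Real.rpow_nonneg (by norm_num) r
  have htri : |x * y - s| ≤ |x * y| + |s| := abs_sub _ _
  rcases le_total |x * y| |s| with h | h
  · calc |x * y - s| ^ r ≤ (2 * |s|) ^ r :=
          Real.rpow_le_rpow (abs_nonneg _) (by linarith) hr0
      _ = 2 ^ r * |s| ^ r := Real.mul_rpow (by norm_num) (abs_nonneg _)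
      _ ≤ _ := mul_le_mul_of_nonneg_left (by linarith) h2
  · calc |x * y - s| ^ r ≤ (2 * |x * y|) ^ r :=
          Real.rpow_le_rpow (abs_nonneg _) (by linarith) hr0
      _ = 2 ^ r * |x * y| ^ r := Real.mul_rpow (by norm_num) (abs_nonneg _)
      _ ≤ _ := mul_le_mul_of_nonneg_left (by linarith) h2

end Moments

/-! ### The error model and its scalar sums -/

section Model

variable {Ω : Type*} [MeasurableSpace Ω] {P : Measure Ω} {n d : ℕ}
  {X₀ : Matrix (Fin n) (Fin d) ℝ} {S : Matrix (Fin n ⊕ Fin d) (Fin n ⊕ Fin d) ℝ}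
  {c : ℕ → Ω → (Fin n ⊕ Fin d) → ℝ}

theorem ErrorModel.posSemidef (h : ErrorModel P X₀ S c) : S.PosSemidef := by
  refine Matrix.PosSemidef.of_dotProduct_mulVec_nonneg ?_ fun v => ?_
  · ext j k
    rw [Matrix.conjTranspose_apply, star_trivial, ← h.cov 0, ← h.cov 0]
    simp only [mul_comm]
  · have hint : ∀ j k, Integrable (fun ω => v j * v k * (c 0 ω j * c 0 ω k)) P := fun j k =>
      ((h.memLp 0 j).integrable_mul (h.memLp 0 k)).const_mul _
    have e : star v ⬝ᵥ S.mulVec v = ∫ ω, (∑ j, v j * c 0 ω j) ^ 2 ∂P := by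
      have e1 : ∀ ω, (∑ j, v j * c 0 ω j) ^ 2
          = ∑ j, ∑ k, v j * v k * (c 0 ω j * c 0 ω k) := by
        intro ω
        rw [sq, Finset.sum_mul_sum]
        exact Finset.sum_congr rfl fun j _ => Finset.sum_congr rfl fun k _ => by ring
      simp only [e1]
      rw [integral_finsetSum _ fun j _ => integrable_finsetSum _ fun k _ => hint j k]
      simp only [star_trivial, dotProduct, Matrix.mulVec]
      refine Finset.sum_congr rfl fun j _ => ?_
      rw [integral_finsetSum _ fun k _ => hint j k, Finset.mul_sum]
      refine Finset.sum_congr rfl fun k _ => ?_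
      rw [integral_const_mul, h.cov]
      ring
    rw [e]
    exact integral_nonneg fun ω => sq_nonneg _

theorem ErrorModel.iIndepFun_coord (h : ErrorModel P X₀ S c) (j : Fin n ⊕ Fin d) :
    iIndepFun (fun i ω => c i ω j) P :=
  h.indep.comp (fun _ x => x j) fun _ => measurable_pi_apply j

theorem ErrorModel.measurable_coord (h : ErrorModel P X₀ S c) (i : ℕ) (j : Fin n ⊕ Fin d) :
    Measurable fun ω => c i ω j :=
  measurable_pi_iff.mp (h.measurable i) j

theorem ErrorModel.iIndepFun_mul_sub (h : ErrorModel P X₀ S c) (j k : Fin n ⊕ Fin d) :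
    iIndepFun (fun i ω => c i ω j * c i ω k - S j k) P :=
  h.indep.comp (fun _ x => x j * x k - S j k) fun _ =>
    ((measurable_pi_apply j).mul (measurable_pi_apply k)).sub_const _

theorem ErrorModel.measurable_mul_sub (h : ErrorModel P X₀ S c) (i : ℕ) (j k : Fin n ⊕ Fin d) :
    Measurable fun ω => c i ω j * c i ω k - S j k :=
  ((h.measurable_coord i j).mul (h.measurable_coord i k)).sub_const _

theorem ErrorModel.integral_sq (h : ErrorModel P X₀ S c) (i : ℕ) (j : Fin n ⊕ Fin d) :
    ∫ ω, c i ω j ^ 2 ∂P ≤ S j j := by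
  simp only [sq, h.cov]
  exact le_rfl

/-- A sufficient condition, in terms of finitely many scalar sums of independent random variables,
for the TLS problem to be well posed. -/
theorem ErrorModel.exists_wellPosed (h : ErrorModel P X₀ S c) (a₀ : ℕ → Fin n → ℝ) :
    ∃ ε : ℝ, 0 < ε ∧ ∃ u : ℕ → Fin n → ℕ → ℝ, ∀ m, 0 < lambdaMinGram (trueA a₀ m) →
      (∀ l, ∑ i ∈ Finset.range m, u m l i ^ 2 = 1) ∧
      ∀ ω, (∀ j k, |∑ i ∈ Finset.range m, (c i ω j * c i ω k - S j k)|
          < ε * lambdaMinGram (trueA a₀ m)) →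
        (∀ l j, (∑ i ∈ Finset.range m, u m l i * c i ω j) ^ 2
          < ε * lambdaMinGram (trueA a₀ m)) →
        AttainedFullRank S (observed a₀ X₀ c m ω) ∧ UniqueSolution S (observed a₀ X₀ c m ω) ∧
          UniqueEstimate S (observed a₀ X₀ c m ω) := by
  obtain ⟨ε, hε, hwell⟩ := exists_wellPosed_of_perturbation h.posSemidef h.rank_eq
  refine ⟨ε, hε, ?_⟩
  have : ∀ m, ∃ u : Fin n → ℕ → ℝ, 0 < lambdaMinGram (trueA a₀ m) →
      (∀ l, ∑ i ∈ Finset.range m, u l i ^ 2 = 1) ∧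
      ∀ ω, (∀ j k, |∑ i ∈ Finset.range m, (c i ω j * c i ω k - S j k)|
          < ε * lambdaMinGram (trueA a₀ m)) →
        (∀ l j, (∑ i ∈ Finset.range m, u l i * c i ω j) ^ 2
          < ε * lambdaMinGram (trueA a₀ m)) →
        AttainedFullRank S (observed a₀ X₀ c m ω) ∧ UniqueSolution S (observed a₀ X₀ c m ω) ∧
          UniqueEstimate S (observed a₀ X₀ c m ω) := by
    intro m
    by_cases hl : 0 < lambdaMinGram (trueA a₀ m)
    · obtain ⟨U, B, hU, hA⟩ := exists_orthonormal_factor hl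
      -- The weights are the columns of the orthonormal factor of `A₀`, extended by zero past `m` so
      -- that the scalar lemmas on sequences apply.
      refine ⟨fun l i => if hi : i < m then U ⟨i, hi⟩ l else 0, fun _ => ⟨fun l => ?_,
        fun ω hW hL => hwell m (trueA a₀ m) U B (Matrix.of fun (i : Fin m) j => c i ω j) hl hU hA
          (fun j k => ?_) fun l j => ?_⟩⟩
      · rw [Finset.sum_range]
        have := congrFun (congrFun hU l) l
        rw [Matrix.one_apply_eq, Matrix.mul_apply] at this
        simpa [sq] using this
      · have h1 := hW j k
        rw [Finset.sum_range, Finset.sum_sub_distrib] at h1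
        simpa using h1.le
      · have h1 := hL l j
        rw [Finset.sum_range] at h1
        simpa [Matrix.mul_apply] using h1.le
    · exact ⟨0, fun hl' => absurd hl' hl⟩
  choose u hu using this
  exact ⟨u, hu⟩

variable [IsProbabilityMeasure P]

theorem ErrorModel.integrable_mul_sub (h : ErrorModel P X₀ S c) (i : ℕ) (j k : Fin n ⊕ Fin d) :
    Integrable (fun ω => c i ω j * c i ω k - S j k) P :=
  ((h.memLp i j).integrable_mul (h.memLp i k)).sub (integrable_const _)

theorem ErrorModel.integral_mul_sub (h : ErrorModel P X₀ S c) (i : ℕ) (j k : Fin n ⊕ Fin d) :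
    ∫ ω, (c i ω j * c i ω k - S j k) ∂P = 0 := by
  have hint : Integrable (fun ω => c i ω j * c i ω k) P :=
    (h.memLp i j).integrable_mul (h.memLp i k)
  rw [integral_sub hint (integrable_const _), h.cov]
  simp

theorem ErrorModel.exists_moment_bound (h : ErrorModel P X₀ S c) {r : ℝ} (hr : 1 ≤ r)
    (hmom : BoundedMoments P c r) (j k : Fin n ⊕ Fin d) : ∃ K : ℝ, ∀ i,
      Integrable (fun ω => |c i ω j * c i ω k - S j k| ^ r) P ∧
        ∫ ω, |c i ω j * c i ω k - S j k| ^ r ∂P ≤ K := by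
  obtain ⟨K, hK⟩ := hmom.exists_bound hr h.measurable
  refine ⟨2 ^ r * (K + K + |S j k| ^ r), fun i => ?_⟩
  have hdom : Integrable
      (fun ω => 2 ^ r * (|c i ω j| ^ (2 * r) + |c i ω k| ^ (2 * r) + |S j k| ^ r)) P :=
    (((hK i j).1.add (hK i k).1).add (integrable_const _)).const_mul _
  have hint : Integrable (fun ω => |c i ω j * c i ω k - S j k| ^ r) P := by
    refine hdom.mono' ((h.measurable_mul_sub i j k).abs.pow_const r).aestronglyMeasurable
      (ae_of_all _ fun ω => ?_)
    rw [Real.norm_of_nonneg (Real.rpow_nonneg (abs_nonneg _) r)]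
    exact abs_mul_sub_rpow_le hr _ _ _
  refine ⟨hint, (integral_mono hint hdom fun ω => abs_mul_sub_rpow_le hr _ _ _).trans ?_⟩
  have h1 : Integrable (fun ω => |c i ω j| ^ (2 * r) + |c i ω k| ^ (2 * r)) P :=
    (hK i j).1.add (hK i k).1
  rw [integral_const_mul, integral_add h1 (integrable_const _),
    integral_add (hK i j).1 (hK i k).1]
  simp only [integral_const, probReal_univ, smul_eq_mul, one_mul]
  have := (hK i j).2
  have := (hK i k).2
  gcongr

end Model

/-! ### Weak and strong consistency -/

section Consistency

variable {Ω : Type*} [MeasurableSpace Ω] {P : Measure Ω} [IsProbabilityMeasure P] {n d : ℕ}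
  {X₀ : Matrix (Fin n) (Fin d) ℝ} {S : Matrix (Fin n ⊕ Fin d) (Fin n ⊕ Fin d) ℝ}
  {c : ℕ → Ω → (Fin n ⊕ Fin d) → ℝ}

theorem tendsto_measure_zero_of_measureReal_le {A : ℕ → Set Ω} {g : ℕ → ℝ}
    (hle : ∀ᶠ m in atTop, P.real (A m) ≤ g m) (hg : Tendsto g atTop (𝓝 0)) :
    Tendsto (fun m => P (A m)) atTop (𝓝 0) := by
  have h1 : Tendsto (fun m => ENNReal.ofReal (g m)) atTop (𝓝 0) := by
    have := ENNReal.tendsto_ofReal hg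
    rwa [ENNReal.ofReal_zero] at this
  refine tendsto_of_tendsto_of_tendsto_of_le_of_le' tendsto_const_nhds h1
    (Eventually.of_forall fun _ => zero_le) ?_
  filter_upwards [hle] with m hm
  rw [← ofReal_measureReal]
  exact ENNReal.ofReal_le_ofReal hm

theorem ErrorModel.withHighProbability (h : ErrorModel P X₀ S c) (a₀ : ℕ → Fin n → ℝ)
    (hweak : WeakCondition P a₀ c) :
    WithHighProbability P (fun m ω =>
      AttainedFullRank S (observed a₀ X₀ c m ω) ∧ UniqueSolution S (observed a₀ X₀ c m ω) ∧
        UniqueEstimate S (observed a₀ X₀ c m ω)) := by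
  obtain ⟨r, hr1, hr2, hmom, hlam⟩ := hweak
  obtain ⟨ε, hε, u, hu⟩ := h.exists_wellPosed a₀
  set lam : ℕ → ℝ := fun m => lambdaMinGram (trueA a₀ m) with hlam_def
  have hr0 : 0 < r := by linarith
  have hlampos : ∀ᶠ m in atTop, 0 < lam m := by
    filter_upwards [hlam.eventually_gt_atTop 0] with m hm
    exact pos_of_mul_pos_right hm (Real.rpow_nonneg (Nat.cast_nonneg m) _)
  have hlamtop : Tendsto lam atTop atTop := by
    refine tendsto_atTop_mono' _ ?_ hlam
    filter_upwards [hlampos, eventually_ge_atTop 1] with m hm hm1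
    refine mul_le_of_le_one_left hm.le ?_
    refine Real.rpow_le_one_of_one_le_of_nonpos (by exact_mod_cast hm1) ?_
    rw [neg_nonpos]
    positivity
  -- `m λ^(-r)` is the `-r`-th power of `m^(-1/r) λ`, which is how the weak condition enters the
  -- truncation bound.
  have hratio : Tendsto (fun m : ℕ => m * (1 / lam m ^ r)) atTop (𝓝 0) := by
    have h1 := (tendsto_rpow_atTop hr0).comp hlam
    refine h1.inv_tendsto_atTop.congr' ?_
    filter_upwards [hlampos] with m hm
    simp only [Pi.inv_apply, Function.comp_apply]
    have hm0 : (0 : ℝ) ≤ m := Nat.cast_nonneg m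
    rw [Real.mul_rpow (Real.rpow_nonneg hm0 _) hm.le, ← Real.rpow_mul hm0,
      neg_mul, one_div_mul_cancel hr0.ne', Real.rpow_neg_one, mul_inv, inv_inv, one_div]
  have hA : ∀ j k, Tendsto (fun m => P {ω | ε * lam m
      ≤ |∑ i ∈ Finset.range m, (c i ω j * c i ω k - S j k)|}) atTop (𝓝 0) := by
    intro j k
    obtain ⟨K, hK⟩ := h.exists_moment_bound hr1 hmom j k
    refine tendsto_measure_zero_of_measureReal_le
      (g := fun m => (√(K * (m * (1 / lam m ^ r))) + 2 * (K * (m * (1 / lam m ^ r)))) / ε) ?_ ?_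
    · filter_upwards [hlampos] with m hm
      have hpow : ∀ i ω, |(c i ω j * c i ω k - S j k) / lam m| ^ r
          = |c i ω j * c i ω k - S j k| ^ r * (1 / lam m ^ r) := by
        intro i ω
        rw [abs_div, abs_of_pos hm, Real.div_rpow (abs_nonneg _) hm.le, ← mul_one_div]
      have hbd := integral_abs_sum_le (Y := fun i ω => (c i ω j * c i ω k - S j k) / lam m)
        ((h.iIndepFun_mul_sub j k).comp (fun _ x => x / lam m) fun _ => measurable_id.div_const _)
        (fun i => (h.measurable_mul_sub i j k).div_const _)
        (fun i => (h.integrable_mul_sub i j k).div_const _)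
        (fun i => by rw [integral_div, h.integral_mul_sub, zero_div]) hr1 hr2
        (fun i => by simp only [hpow]; exact (hK i).1.mul_const _)
        (b := fun _ => K * (1 / lam m ^ r))
        (fun i => by
          simp only [hpow]
          rw [integral_mul_const]
          exact mul_le_mul_of_nonneg_right (hK i).2
            (one_div_nonneg.mpr (Real.rpow_nonneg hm.le r))) (Finset.range m)
      rw [Finset.sum_const, Finset.card_range, nsmul_eq_mul, mul_left_comm] at hbd
      rw [le_div_iff₀ hε, mul_comm]
      refine le_trans ?_ hbd
      have hmk := mul_meas_ge_le_integral_of_nonneg (μ := P)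
        (f := fun ω => |∑ i ∈ Finset.range m, (c i ω j * c i ω k - S j k) / lam m|)
        (ae_of_all _ fun ω => abs_nonneg _)
        (integrable_finsetSum _ fun i _ => (h.integrable_mul_sub i j k).div_const _).abs ε
      -- Dividing the summands by `λ` turns the threshold `ε λ` into the constant `ε` of Markov's
      -- inequality.
      refine le_trans (le_of_eq ?_) hmk
      congr 3
      ext ω
      rw [← Finset.sum_div, abs_div, abs_of_pos hm, le_div_iff₀ hm]
    · have h1 := hratio.const_mul K
      rw [mul_zero] at h1
      have h2 := (Real.continuous_sqrt.tendsto 0).comp h1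
      rw [Real.sqrt_zero] at h2
      have h3 := (h2.add (h1.const_mul 2)).div_const ε
      simpa using h3
  have hB : ∀ l j, Tendsto (fun m => P {ω | ε * lam m
      ≤ (∑ i ∈ Finset.range m, u m l i * c i ω j) ^ 2}) atTop (𝓝 0) := by
    intro l j
    refine tendsto_measure_zero_of_measureReal_le (g := fun m => S j j / (ε * lam m)) ?_
      (tendsto_const_nhds.div_atTop (hlamtop.const_mul_atTop hε))
    filter_upwards [hlampos] with m hm
    exact measureReal_linear_sq_ge_le (h.iIndepFun_coord j) (fun i => h.measurable_coord i j)
      (fun i => h.memLp i j) (fun i => h.mean i j) (fun i => h.integral_sq i j) ((hu m hm).1 l)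
      (mul_pos hε hm)
  have hsum : Tendsto (fun m => ∑ j, ∑ k, P {ω | ε * lam m
        ≤ |∑ i ∈ Finset.range m, (c i ω j * c i ω k - S j k)|}
      + ∑ l, ∑ j, P {ω | ε * lam m ≤ (∑ i ∈ Finset.range m, u m l i * c i ω j) ^ 2})
      atTop (𝓝 0) := by
    have h1 := tendsto_finsetSum Finset.univ fun j _ =>
      tendsto_finsetSum Finset.univ fun k _ => hA j k
    have h2 := tendsto_finsetSum Finset.univ fun l _ =>
      tendsto_finsetSum Finset.univ fun j _ => hB l j
    simpa using h1.add h2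
  refine tendsto_of_tendsto_of_tendsto_of_le_of_le' tendsto_const_nhds hsum
    (Eventually.of_forall fun _ => zero_le) ?_
  filter_upwards [hlampos] with m hm
  have hsub : {ω | ¬ (AttainedFullRank S (observed a₀ X₀ c m ω) ∧
        UniqueSolution S (observed a₀ X₀ c m ω) ∧ UniqueEstimate S (observed a₀ X₀ c m ω))}
      ⊆ (⋃ j, ⋃ k, {ω | ε * lam m ≤ |∑ i ∈ Finset.range m, (c i ω j * c i ω k - S j k)|})
        ∪ ⋃ l, ⋃ j, {ω | ε * lam m ≤ (∑ i ∈ Finset.range m, u m l i * c i ω j) ^ 2} := by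
    intro ω hω
    by_contra hcon
    simp only [Set.mem_union, Set.mem_iUnion, Set.mem_ofPred_eq, not_or, not_exists,
      not_le] at hcon
    exact hω ((hu m hm).2 ω hcon.1 hcon.2)
  refine (measure_mono hsub).trans ((measure_union_le _ _).trans (add_le_add ?_ ?_))
  · exact (measure_iUnion_fintype_le _ _).trans
      (Finset.sum_le_sum fun j _ => measure_iUnion_fintype_le _ _)
  · exact (measure_iUnion_fintype_le _ _).trans
      (Finset.sum_le_sum fun j _ => measure_iUnion_fintype_le _ _)

/-- The covariances form sums of one fixed sequence, so the strong law applies. The weights `u m`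
change with `m`, so the components form no such sequence and are handled by Borel–Cantelli. -/
theorem ErrorModel.occursEventually_of_low (h : ErrorModel P X₀ S c) (hn : 1 ≤ n)
    (a₀ : ℕ → Fin n → ℝ) (hlow : StrongConditionLow P a₀ c) :
    OccursEventually P (fun m ω =>
      AttainedFullRank S (observed a₀ X₀ c m ω) ∧ UniqueSolution S (observed a₀ X₀ c m ω) ∧
        UniqueEstimate S (observed a₀ X₀ c m ω)) := by
  obtain ⟨r, m₀, hr1, hr2, -, hmom, hpos, hsum⟩ := hlow
  obtain ⟨ε, hε, u, hu⟩ := h.exists_wellPosed a₀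
  have hmono := lambdaMinGram_trueA_mono hn a₀
  set lam : ℕ → ℝ := fun m => lambdaMinGram (trueA a₀ m) with hlam_def
  have hr0 : 0 < r := by linarith
  -- Freezing `λ_min` below `m₀` makes it positive everywhere while keeping it monotone.
  set b : ℕ → ℝ := fun m => lam (max m m₀) with hb
  have hbmono : Monotone b := fun i j hij => hmono (max_le_max_right m₀ hij)
  have hb0 : ∀ i, 0 < b i := fun i => hpos _ (le_max_right _ _)
  have hbeq : ∀ m, m₀ ≤ m → b m = lam m := fun m hm => by simp only [hb, max_eq_left hm]
  have hbsum : Summable fun i => 1 / b i ^ r := by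
    rw [← summable_nat_add_iff m₀]
    refine hsum.congr fun k => ?_
    rw [hbeq _ (Nat.le_add_left _ _), add_comm]
  have hbtop := tendsto_atTop_of_summable_one_div_rpow hb0 hr1 hbsum
  -- Since `r ≤ 2` and `b` tends to infinity, `b^(-2) ≤ b^(-r)` eventually; this serves the
  -- off-diagonal part of the tail bound.
  have hbsum2 : Summable fun i => 1 / b i ^ 2 := by
    refine Summable.of_norm_bounded_eventually_nat hbsum ?_
    filter_upwards [hbtop.eventually_ge_atTop 1] with i hi
    rw [Real.norm_of_nonneg (by positivity)]
    refine one_div_le_one_div_of_le (Real.rpow_pos_of_pos (hb0 i) r) ?_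
    rw [← Real.rpow_natCast]
    exact Real.rpow_le_rpow_of_exponent_le hi (by simpa using hr2)
  have hA : ∀ j k, ∀ᵐ ω ∂P, ∀ᶠ m in atTop,
      |∑ i ∈ Finset.range m, (c i ω j * c i ω k - S j k)| < ε * b m := by
    intro j k
    obtain ⟨K, hK⟩ := h.exists_moment_bound hr1 hmom j k
    filter_upwards [ae_tendsto_sum_div (h.iIndepFun_mul_sub j k)
      (fun i => h.measurable_mul_sub i j k) (fun i => h.integrable_mul_sub i j k)
      (fun i => h.integral_mul_sub i j k) hr1 hr2 (fun i => (hK i).1) (fun i => (hK i).2)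
      hbmono hb0 hbsum] with ω hω
    filter_upwards [hω.abs.eventually (gt_mem_nhds (by rwa [abs_zero] : |(0 : ℝ)| < ε))] with m hm
    rwa [abs_div, abs_of_pos (hb0 m), div_lt_iff₀ (hb0 m)] at hm
  have hB : ∀ l j, ∀ᵐ ω ∂P, ∀ᶠ m in atTop, m₀ ≤ m →
      (∑ i ∈ Finset.range m, u m l i * c i ω j) ^ 2 < ε * b m := by
    intro l j
    obtain ⟨K, hK⟩ := hmom.exists_bound hr1 h.measurable
    set A : ℕ → Set Ω := fun m =>
      {ω | m₀ ≤ m ∧ ε * b m ≤ (∑ i ∈ Finset.range m, u m l i * c i ω j) ^ 2} with hAdef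
    have hK0 : 0 ≤ K :=
      (integral_nonneg fun ω => Real.rpow_nonneg (abs_nonneg _) _).trans (hK 0 j).2
    have hbound : ∀ m, P.real (A m) ≤ K / (ε / 2) ^ r * (1 / b m ^ r)
        + 2 * S j j ^ 2 / (ε / 2) ^ 2 * (1 / b m ^ 2) := by
      intro m
      have hbm := hb0 m
      by_cases hm : m₀ ≤ m
      · have hlm : 0 < lam m := hpos m hm
        have h1 := measureReal_linear_sq_ge_le_rpow (h.iIndepFun_coord j)
          (fun i => h.measurable_coord i j) (fun i => h.memLp i j) (fun i => h.mean i j)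
          (fun i => h.integral_sq i j) hr1 (fun i => (hK i j).1) (fun i => (hK i j).2)
          ((hu m hlm).1 l) (mul_pos hε hbm)
        have e1 : ε * b m / 2 = ε / 2 * b m := by ring
        rw [e1, Real.mul_rpow (by positivity) hbm.le, mul_pow] at h1
        refine (measureReal_mono fun ω hω => hω.2).trans (h1.trans_eq ?_)
        rw [div_mul_div_comm, div_mul_div_comm, mul_one, mul_one]
      · have : A m = ∅ := by
          ext ω
          simp [hAdef, hm]
        rw [this, measureReal_empty]
        positivity
    have hfin : ∑' m, P (A m) ≠ ⊤ := by
      have hs : Summable fun m => K / (ε / 2) ^ r * (1 / b m ^ r)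
          + 2 * S j j ^ 2 / (ε / 2) ^ 2 * (1 / b m ^ 2) :=
        (hbsum.mul_left _).add (hbsum2.mul_left _)
      refine ne_top_of_le_ne_top hs.tsum_ofReal_ne_top (ENNReal.tsum_le_tsum fun m => ?_)
      rw [← ofReal_measureReal]
      exact ENNReal.ofReal_le_ofReal (hbound m)
    filter_upwards [ae_eventually_notMem hfin] with ω hω
    filter_upwards [hω] with m hm hm0
    by_contra hcon
    exact hm ⟨hm0, not_lt.mp hcon⟩
  have hA' := ae_all_iff.mpr fun j => ae_all_iff.mpr fun k => hA j k
  have hB' := ae_all_iff.mpr fun l => ae_all_iff.mpr fun j => hB l j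
  filter_upwards [hA', hB'] with ω h1 h2
  have hev : ∀ᶠ m in atTop, AttainedFullRank S (observed a₀ X₀ c m ω) ∧
      UniqueSolution S (observed a₀ X₀ c m ω) ∧ UniqueEstimate S (observed a₀ X₀ c m ω) := by
    filter_upwards [eventually_all.mpr fun j => eventually_all.mpr fun k => h1 j k,
      eventually_all.mpr fun l => eventually_all.mpr fun j => h2 l j,
      eventually_ge_atTop m₀] with m hm1 hm2 hm0
    refine (hu m (hpos m hm0)).2 ω (fun j k => ?_) fun l j => ?_
    · have := hm1 j k
      rwa [hbeq m hm0] at this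
    · have := hm2 l j hm0
      rwa [hbeq m hm0] at this
  obtain ⟨m₁, hm₁⟩ := eventually_atTop.mp hev
  exact ⟨m₁, fun m hm => hm₁ m hm.le⟩

/-- By monotonicity of `λ_min`, summability of `(√m / λ_min)^r` forces `λ_min` to grow so fast that
the sum of `λ_min⁻²` is finite as well. -/
theorem StrongConditionHigh.low (hn : 1 ≤ n) {a₀ : ℕ → Fin n → ℝ}
    (hhigh : StrongConditionHigh P a₀ c) : StrongConditionLow P a₀ c := by
  obtain ⟨r, m₀, hr, hm₀, hmom, hpos, hsum⟩ := hhigh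
  have hmono := lambdaMinGram_trueA_mono hn a₀
  set lam : ℕ → ℝ := fun m => lambdaMinGram (trueA a₀ m) with hlam_def
  refine ⟨2, m₀, one_le_two, le_rfl, hm₀, hmom.mono (by norm_num) hr, hpos, ?_⟩
  have hr0 : 0 < r := by linarith
  set T := ∑' k : ℕ, (√((m₀ + k : ℕ) : ℝ) / lam (m₀ + k)) ^ r with hT
  have hl : ∀ k, 0 < lam (m₀ + k) := fun k => hpos _ (Nat.le_add_right _ _)
  have hterm : ∀ k : ℕ, 0 ≤ (√((m₀ + k : ℕ) : ℝ) / lam (m₀ + k)) ^ r := fun k =>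
    Real.rpow_nonneg (div_nonneg (Real.sqrt_nonneg _) (hl k).le) r
  have hT0 : 0 ≤ T := tsum_nonneg hterm
  -- On `[k/2, k)` there are at least `k/2` summands, each bounded below by the value with `λ` taken
  -- at the right end. Since `m₀ ≥ 1`, `m₀ + i ≥ k/2` holds despite the rounding for odd `k`.
  have hblock : ∀ k : ℕ, ((k : ℝ) / 2) * (√((k : ℝ) / 2) / lam (m₀ + k)) ^ r ≤ T := by
    intro k
    refine le_trans ?_ (hsum.sum_le_tsum (Finset.Ico (k / 2) k) fun i _ => hterm i)
    have hq0 : 0 ≤ (√((k : ℝ) / 2) / lam (m₀ + k)) ^ r :=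
      Real.rpow_nonneg (div_nonneg (Real.sqrt_nonneg _) (hl k).le) r
    have hcard : (k : ℝ) / 2 ≤ ((Finset.Ico (k / 2) k).card : ℝ) := by
      rw [Nat.card_Ico]
      have h2 : k ≤ 2 * (k - k / 2) := by omega
      have h3 : (k : ℝ) ≤ 2 * ((k - k / 2 : ℕ) : ℝ) := by exact_mod_cast h2
      linarith
    calc ((k : ℝ) / 2) * (√((k : ℝ) / 2) / lam (m₀ + k)) ^ r
        ≤ ((Finset.Ico (k / 2) k).card : ℝ) * (√((k : ℝ) / 2) / lam (m₀ + k)) ^ r :=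
          mul_le_mul_of_nonneg_right hcard hq0
      _ = ∑ i ∈ Finset.Ico (k / 2) k, (√((k : ℝ) / 2) / lam (m₀ + k)) ^ r := by
          rw [Finset.sum_const, nsmul_eq_mul]
      _ ≤ _ := by
          refine Finset.sum_le_sum fun i hi => ?_
          rw [Finset.mem_Ico] at hi
          have h4 : (k : ℝ) / 2 ≤ ((m₀ + i : ℕ) : ℝ) := by
            have h2 : k ≤ 2 * (m₀ + i) := by omega
            have h3 : (k : ℝ) ≤ 2 * ((m₀ + i : ℕ) : ℝ) := by exact_mod_cast h2
            linarith
          refine Real.rpow_le_rpow (div_nonneg (Real.sqrt_nonneg _) (hl k).le) ?_ hr0.le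
          exact div_le_div₀ (Real.sqrt_nonneg _) (Real.sqrt_le_sqrt h4) (hl i)
            (hmono (by omega))
  have hbig : Summable fun k : ℕ =>
      T ^ (2 / r) * (2 : ℝ) ^ (1 + 2 / r) * (1 / (k : ℝ) ^ (1 + 2 / r)) :=
    (Real.summable_one_div_nat_rpow.mpr (by linarith [show 0 < 2 / r by positivity])).mul_left _
  refine Summable.of_norm_bounded_eventually_nat hbig ?_
  filter_upwards [eventually_ge_atTop 1] with k hk
  have hk0 : (0 : ℝ) < k := by exact_mod_cast hk
  have hlk := hl k
  rw [Real.norm_of_nonneg (one_div_nonneg.mpr (Real.rpow_nonneg hlk.le _))]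
  -- Raising the block bound to the power `2/r` isolates `λ^(-2)` and yields `λ^(-2) = O(k^(-(1 +
  -- 2/r)))`, which is summable.
  have h1 : (((k : ℝ) / 2) * (√((k : ℝ) / 2) / lam (m₀ + k)) ^ r) ^ (2 / r) ≤ T ^ (2 / r) :=
    Real.rpow_le_rpow (by positivity) (hblock k) (by positivity)
  have h2 : (((k : ℝ) / 2) * (√((k : ℝ) / 2) / lam (m₀ + k)) ^ r) ^ (2 / r)
      = ((k : ℝ) / 2) ^ (1 + 2 / r) * (1 / lam (m₀ + k) ^ (2 : ℝ)) := by
    rw [Real.mul_rpow (by positivity) (by positivity), ← Real.rpow_mul (by positivity),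
      mul_div_cancel₀ 2 hr0.ne', Real.div_rpow (by positivity) hlk.le, Real.rpow_two,
      Real.sq_sqrt (by positivity), Real.rpow_add (by positivity), Real.rpow_one]
    ring
  rw [h2, Real.div_rpow hk0.le (by norm_num)] at h1
  have h3 : (0 : ℝ) < k ^ (1 + 2 / r) := by positivity
  have h4 : (0 : ℝ) < 2 ^ (1 + 2 / r) := by positivity
  rw [div_mul_eq_mul_div, div_le_iff₀ h4] at h1
  rw [mul_one_div, le_div_iff₀ h3, mul_comm]
  exact h1

end Consistency

end TLS

theorem mainTheorem4 {Ω : Type*} [MeasurableSpace Ω] (P : Measure Ω) [IsProbabilityMeasure P]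
    {n d : ℕ} (hn : 1 ≤ n) (hd : 1 ≤ d)
    (a₀ : ℕ → Fin n → ℝ) (X₀ : Matrix (Fin n) (Fin d) ℝ)
    (S : Matrix (Fin n ⊕ Fin d) (Fin n ⊕ Fin d) ℝ)
    (c : ℕ → Ω → (Fin n ⊕ Fin d) → ℝ) (hmodel : TLS.ErrorModel P X₀ S c) :
    (TLS.WeakCondition P a₀ c →
      TLS.WithHighProbability P (fun m ω =>
        TLS.AttainedFullRank S (TLS.observed a₀ X₀ c m ω) ∧
        TLS.UniqueSolution S (TLS.observed a₀ X₀ c m ω) ∧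
        TLS.UniqueEstimate S (TLS.observed a₀ X₀ c m ω))) ∧
    (TLS.StrongConditionHigh P a₀ c ∨ TLS.StrongConditionLow P a₀ c →
      TLS.OccursEventually P (fun m ω =>
        TLS.AttainedFullRank S (TLS.observed a₀ X₀ c m ω) ∧
        TLS.UniqueSolution S (TLS.observed a₀ X₀ c m ω) ∧
        TLS.UniqueEstimate S (TLS.observed a₀ X₀ c m ω))) := by
  refine ⟨fun h => hmodel.withHighProbability a₀ h, ?_⟩
  rintro (h | h)
  · exact hmodel.occursEventually_of_low hn a₀ (h.low hn)
  · exact hmodel.occursEventually_of_low hn a₀ h
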